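/- \textbf{Theorem (tame imprintings and manifold submersions).} We use the sc-calculus of Hofer, Wysocki and Zehnder. An M-polyfold is a Hausdorff paracompact space with an equivalence class of sc-smooth atlases whose charts are homeomorphisms onto sc-smooth retracts $(O,C,E)$, where $O=r(U)$, $U$ is relatively open in a partial quadrant $C$ of an sc-Banach space $E$, and $r:U\to U$ is sc-smooth with $r\circ r=r$. The retraction $r$ is tame if $d_C(r(x))=d_C(x)$ for all $x\in U$ and, at every smooth point $x\in O$, there is an sc-subspace $A\subset E_x$ with $E=T_xO\oplus A$ as an sc-direct sum. Here, writing $C=[0,\infty)^n\oplus W\subset E=\mathbb R^n\oplus W$ (after an sc-isomorphism), $d_C(x)$ is the number of indices $i$ with $x_i=0$, and $E_x$ is the subspace of all vectors whose $i$-th coordinate vanishes whenever $x_i=0$. An M-polyfold is tame if it is metrizable and its structure is given by an atlas of charts onto images of tame retractions. The degeneracy index $d_X(x)$ is the minimum of $d_C(\varphi(x))$ over all compatible charts $\varphi$ around $x$ with values in a retract $(O,C,E)$. An sc-smooth map $p:X\to Z$ of M-polyfolds is \emph{submersive} if it is surjective and every point $(x_0,p(x_0))$ of its graph $\mathrm{Gr}(p)$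 has an open neighbourhood $U\subset X\times Z$ with an sc-smooth map $\rho:U\to U$ of the form $\rho(x,z)=(\bar\rho(x,z),z)$ such that $\rho\circ\rho=\rho$ and $\rho(U)=U\cap\mathrm{Gr}(p)$. A surjective map $\oplus:X\to Y$ from an M-polyfold onto a set is an \emph{imprinting} if the quotient topology on $Y$ is metrizable and every $y\in Y$ has an open neighbourhood $V_y$ with a map $H:V_y\to X$ such that $\oplus\circ H=\mathrm{Id}_{V_y}$ and $H\circ\oplus:\oplus^{-1}(V_y)\to X$ is sc-smooth. Its \emph{induced structure} on $Y$ is the unique M-polyfold structure (for the quotient topology) such that $\oplus$ is sc-smooth and every $y\in Y$ has an open neighbourhood $V_y$ with an sc-smooth map $H:V_y\to X$ satisfying $\oplus\circ H=\mathrm{Id}_{V_y}$. Let $X$ be a tame M-polyfold, $V$ a smooth finite-dimensional manifold with boundary with corners, and $p:X\to V$ an sc-smooth submersive map such that $d_V(p(x))=d_X(x)$ for all $x\in X$. Let $\oplus:X\to Y$ be an imprinting and $p':Y\to V$ a map with $p'\circ\oplus=p$. Then the induced M-polyfold structure on $Y$ exists and is unique, and for this structure: \begin{enumerate} \item $Y$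 is tame; \item $p':Y\to V$ is sc-smooth and submersive; \item $d_V(p'(y))=d_Y(y)$ for all $y\in Y$. \end{enumerate} -/

import Mathlib

open Set Filter Topology
open scoped ContDiff

universe u v w z t

/-! ## Sc-Banach spaces -/

/-- An sc-Banach space `E = E₀ ⊇ E₁ ⊇ E₂ ⊇ ⋯`.  The nested linear subspaces, each with its own
Banach space structure, are recorded as Banach spaces `lev i` together with the (injective, compact)
inclusion operators `lev (i + 1) → lev i`.  A point of `E_∞ = ⋂ E_j` is recorded by the family `s`
of its representatives in the `lev j`; `E_∞` is dense in every `lev i`. -/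
structure ScBanach where
  lev : ℕ → Type u
  [normed : ∀ i, NormedAddCommGroup (lev i)]
  [space : ∀ i, NormedSpace ℝ (lev i)]
  [complete : ∀ i, CompleteSpace (lev i)]
  incl : ∀ i, lev (i + 1) →L[ℝ] lev i
  incl_injective : ∀ i, Function.Injective (incl i)
  incl_compact : ∀ i, IsCompactOperator (incl i)
  dense_smooth : ∀ i, Dense {x : lev i |
    ∃ s : ∀ j, lev j, (∀ j, incl j (s (j + 1)) = s j) ∧ s i = x}

namespace ScBanach

attribute [instance] ScBanach.normed ScBanach.space ScBanach.complete

/-- The inclusion `E_i → E_0`. -/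
noncomputable def toZero (E : ScBanach.{u}) : ∀ i, E.lev i →L[ℝ] E.lev 0
  | 0 => ContinuousLinearMap.id ℝ (E.lev 0)
  | i + 1 => (E.toZero i).comp (E.incl i)

/-- The point `x ∈ E_i` belongs to `E_∞`. -/
def IsSmoothPt (E : ScBanach.{u}) {i : ℕ} (x : E.lev i) : Prop :=
  ∃ s : ∀ j, E.lev j, (∀ j, E.incl j (s (j + 1)) = s j) ∧ s i = x

/-- For `U ⊆ E`, the set `U_i = U ∩ E_i`, as a subset of `E_i`. -/
def levelSet (E : ScBanach.{u}) (U : Set (E.lev 0)) (i : ℕ) : Set (E.lev i) :=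
  E.toZero i ⁻¹' U

theorem isCompactOperator_prodMap {A B C D : Type*}
    [NormedAddCommGroup A] [NormedSpace ℝ A] [NormedAddCommGroup B] [NormedSpace ℝ B]
    [NormedAddCommGroup C] [NormedSpace ℝ C] [NormedAddCommGroup D] [NormedSpace ℝ D]
    {f : A →L[ℝ] B} {g : C →L[ℝ] D} (hf : IsCompactOperator f) (hg : IsCompactOperator g) :
    IsCompactOperator (f.prodMap g) := by
  obtain ⟨K, hK, hfK⟩ := hf
  obtain ⟨L, hL, hgL⟩ := hg
  refine ⟨K ×ˢ L, hK.prod hL, ?_⟩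
  have h : (f.prodMap g) ⁻¹' (K ×ˢ L) = (f ⁻¹' K) ×ˢ (g ⁻¹' L) := by
    ext ⟨a, c⟩
    simp
  rw [h]
  exact prod_mem_nhds hfK hgL

/-- The sc-direct sum, `(E ⊕ F)_i = E_i ⊕ F_i`. -/
noncomputable def prod (E : ScBanach.{u}) (F : ScBanach.{v}) : ScBanach.{max u v} where
  lev i := E.lev i × F.lev i
  incl i := (E.incl i).prodMap (F.incl i)
  incl_injective i := (E.incl_injective i).prodMap (F.incl_injective i)
  incl_compact i := isCompactOperator_prodMap (E.incl_compact i) (F.incl_compact i)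
  dense_smooth i := by
    refine ((E.dense_smooth i).prod (F.dense_smooth i)).mono ?_
    rintro ⟨x, y⟩ ⟨⟨s, hs, hsx⟩, ⟨t, ht, hty⟩⟩
    exact ⟨fun j => (s j, t j), fun j => Prod.ext (hs j) (ht j), Prod.ext hsx hty⟩

/-- The tangent space `TE = E¹ ⊕ E`, with `(TE)_i = E_{i+1} ⊕ E_i`. -/
noncomputable def tangent (E : ScBanach.{u}) : ScBanach.{u} where
  lev i := E.lev (i + 1) × E.lev i
  incl i := (E.incl (i + 1)).prodMap (E.incl i)
  incl_injective i := (E.incl_injective (i + 1)).prodMap (E.incl_injective i)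
  incl_compact i := isCompactOperator_prodMap (E.incl_compact (i + 1)) (E.incl_compact i)
  dense_smooth i := by
    refine ((E.dense_smooth (i + 1)).prod (E.dense_smooth i)).mono ?_
    rintro ⟨x, y⟩ ⟨⟨s, hs, hsx⟩, ⟨t, ht, hty⟩⟩
    exact ⟨fun j => (s (j + 1), t j), fun j => Prod.ext (hs (j + 1)) (ht j), Prod.ext hsx hty⟩

/-- `ℝ^ι` for a finite index set `ι`, with its (constant) sc-structure. -/
noncomputable def euclid (ι : Type) [Fintype ι] : ScBanach.{0} where
  lev _ := ι → ℝ
  incl _ := ContinuousLinearMap.id ℝ (ι → ℝ)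
  incl_injective _ := fun _ _ h => h
  incl_compact _ := isCompactOperator_of_locallyCompactSpace_dom (ContinuousLinearMap.id ℝ (ι → ℝ))
  dense_smooth _ := fun x => subset_closure ⟨fun _ => x, fun _ => rfl, rfl⟩

end ScBanach

/-- An sc-isomorphism: a linear bijection that restricts to an isomorphism of Banach spaces
`E_i → F_i` for every `i`. -/
structure ScIso (E : ScBanach.{u}) (F : ScBanach.{v}) where
  equiv : ∀ i, E.lev i ≃L[ℝ] F.lev i
  comm : ∀ i (x : E.lev (i + 1)), F.incl i (equiv (i + 1) x) = equiv i (E.incl i x)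

/-- An sc-subspace `A` of `E`: a closed subspace such that the `A_i = A ∩ E_i` form an sc-structure
on `A`.  (Each `A_i` is a closed subspace of `E_i` and the inclusions `A_{i+1} → A_i` are
compact since `A` is closed, so what remains is that `A_∞` is dense in every `A_i`.) -/
def IsScSubspace (E : ScBanach.{u}) (A : Submodule ℝ (E.lev 0)) : Prop :=
  IsClosed (A : Set (E.lev 0)) ∧
    ∀ i, E.levelSet (A : Set (E.lev 0)) i ⊆
      closure {x : E.lev i | x ∈ E.levelSet (A : Set (E.lev 0)) i ∧ E.IsSmoothPt x}

/-- `E = A ⊕ B` with `E_i = A_i ⊕ B_i` for all `i`. -/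
def IsScDirectSum (E : ScBanach.{u}) (A B : Submodule ℝ (E.lev 0)) : Prop :=
  ∀ i, IsCompl (A.comap (E.toZero i).toLinearMap) (B.comap (E.toZero i).toLinearMap)

/-! ## Partial quadrants -/

/-- A partial quadrant `C = T ([0, ∞)^idx ⊕ W)` in `E`, with `T : ℝ^idx ⊕ W → E` an sc-isomorphism
and `idx` a finite set. -/
structure PartialQuadrant (E : ScBanach.{u}) where
  idx : Type
  [fintype_idx : Fintype idx]
  W : ScBanach.{u}
  T : ScIso ((ScBanach.euclid idx).prod W) E

namespace PartialQuadrant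

attribute [instance] PartialQuadrant.fintype_idx

variable {E : ScBanach.{u}} {F : ScBanach.{v}}

/-- The `ℝ^idx` component of `T⁻¹ x`. -/
noncomputable def coord (C : PartialQuadrant E) (x : E.lev 0) : C.idx → ℝ :=
  ((C.T.equiv 0).symm x : (C.idx → ℝ) × C.W.lev 0).1

/-- The underlying subset of `E`. -/
def carrier (C : PartialQuadrant E) : Set (E.lev 0) := {x | ∀ i, 0 ≤ C.coord x i}

/-- The degeneracy index `d_C`. -/
noncomputable def degeneracy (C : PartialQuadrant E) (x : E.lev 0) : ℕ :=
  {i | C.coord x i = 0}.ncard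

/-- The subspace `E_x`: all vectors whose `i`-th coordinate vanishes whenever that of `x` does. -/
def facePlane (C : PartialQuadrant E) (x : E.lev 0) : Set (E.lev 0) :=
  {h | ∀ i, C.coord x i = 0 → C.coord h i = 0}

/-- `U` is a relatively open subset of `C`. -/
def IsRelOpen (C : PartialQuadrant E) (U : Set (E.lev 0)) : Prop :=
  ∃ G : Set (E.lev 0), IsOpen G ∧ U = G ∩ C.carrier

/-- The partial quadrant `C × D` in `E ⊕ F`. -/
noncomputable def prod (C : PartialQuadrant E) (D : PartialQuadrant F) :
    PartialQuadrant (E.prod F) where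
  idx := C.idx ⊕ D.idx
  W := C.W.prod D.W
  T :=
    { equiv := fun i =>
        (((ContinuousLinearEquiv.sumPiEquivProdPi ℝ C.idx D.idx (fun _ => ℝ)).prodCongr
          (ContinuousLinearEquiv.refl ℝ (C.W.lev i × D.W.lev i))).trans
          (ContinuousLinearEquiv.prodProdProdComm ℝ (C.idx → ℝ) (D.idx → ℝ)
            (C.W.lev i) (D.W.lev i))).trans
          ((C.T.equiv i).prodCongr (D.T.equiv i))
      comm := fun i x => Prod.ext (C.T.comm i (fun k => x.1 (Sum.inl k), x.2.1))
        (D.T.comm i (fun k => x.1 (Sum.inr k), x.2.2)) }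

end PartialQuadrant

/-! ## Sc-smooth maps -/

/-- `f : U → F` is sc⁰: for every `i` it restricts to a continuous map `U_i → F_i`. -/
def ScCont {E : ScBanach.{u}} {F : ScBanach.{v}} (f : E.lev 0 → F.lev 0) (U : Set (E.lev 0)) :
    Prop :=
  ∀ i, ∃ g : E.lev i → F.lev i, ContinuousOn g (E.levelSet U i) ∧
    ∀ x ∈ E.levelSet U i, F.toZero i (g x) = f (E.toZero i x)

/-- `D` is an sc-derivative of `f : U → F` at `x ∈ U_1`: a bounded operator `E_0 → F_0` with
`|f (x + h) - f x - D h|_0 / |h|_1 → 0` as `|h|_1 → 0`, `x + h ∈ U_1`. -/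
def HasScDerivAt {E : ScBanach.{u}} {F : ScBanach.{v}} (f : E.lev 0 → F.lev 0)
    (U : Set (E.lev 0)) (x : E.lev 1) (D : E.lev 0 →L[ℝ] F.lev 0) : Prop :=
  HasFDerivWithinAt (fun y : E.lev 1 => f (E.incl 0 y)) (D.comp (E.incl 0)) (E.incl 0 ⁻¹' U) x

/-- `f : U → F` is of class sc^k.  In the successor step, `f₁` is `f` on the level `1` and
`(x, h) ↦ (f₁ x, D x h)` is the tangent map `Tf : TU = U_1 ⊕ E_0 → TF`. -/
def ScDiff : ℕ → ∀ {E : ScBanach.{u}} {F : ScBanach.{v}}, (E.lev 0 → F.lev 0) →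
    Set (E.lev 0) → Prop
  | 0, _, _, f, U => ScCont f U
  | k + 1, E, F, f, U => ScCont f U ∧
      ∃ (f₁ : E.lev 1 → F.lev 1) (D : E.lev 1 → E.lev 0 →L[ℝ] F.lev 0),
        (∀ x ∈ E.incl 0 ⁻¹' U, F.incl 0 (f₁ x) = f (E.incl 0 x) ∧ HasScDerivAt f U x (D x)) ∧
        ScDiff k (E := E.tangent) (F := F.tangent)
          (fun z : E.lev 1 × E.lev 0 => ((f₁ z.1, D z.1 z.2) : F.lev 1 × F.lev 0))
          {z : E.lev 1 × E.lev 0 | E.incl 0 z.1 ∈ U}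

/-- `f : U → F` is sc-smooth. -/
def ScSmooth {E : ScBanach.{u}} {F : ScBanach.{v}} (f : E.lev 0 → F.lev 0) (U : Set (E.lev 0)) :
    Prop :=
  ∀ k, ScDiff k f U

/-! ## Sc-smooth retracts -/

section Retracts

variable {E : ScBanach.{u}}

/-- `r : U → U` is an sc-smooth retraction on the relatively open subset `U` of `C`. -/
structure IsScRetraction (C : PartialQuadrant E) (U : Set (E.lev 0)) (r : E.lev 0 → E.lev 0) :
    Prop where
  relOpen : C.IsRelOpen U
  mapsTo : MapsTo r U U
  smooth : ScSmooth r U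
  idem : ∀ x ∈ U, r (r x) = r x

/-- `(O, C, E)` is an sc-smooth model: `O` is the image of an sc-smooth retraction. -/
def IsScRetract (C : PartialQuadrant E) (O : Set (E.lev 0)) : Prop :=
  ∃ (U : Set (E.lev 0)) (r : E.lev 0 → E.lev 0), IsScRetraction C U r ∧ r '' U = O

/-- An sc-smooth retraction `r : U → U` is tame: it preserves `d_C`, and at every smooth point
`x ∈ O = r(U)` there is an sc-subspace `A ⊆ E_x` with `E = T_x O ⊕ A`.  Here
`T_x O = Dr(x) E` is the fibre over `x` of `TO = Tr(TU)`. -/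
def IsTameRetraction (C : PartialQuadrant E) (U : Set (E.lev 0)) (r : E.lev 0 → E.lev 0) : Prop :=
  IsScRetraction C U r ∧
  (∀ x ∈ U, C.degeneracy (r x) = C.degeneracy x) ∧
  ∀ x : E.lev 1, E.IsSmoothPt x → E.incl 0 x ∈ r '' U →
    ∃ D : E.lev 0 →L[ℝ] E.lev 0, HasScDerivAt r U x D ∧
      ∃ A : Submodule ℝ (E.lev 0), IsScSubspace E A ∧
        IsScDirectSum E (LinearMap.range D.toLinearMap) A ∧
        (A : Set (E.lev 0)) ⊆ C.facePlane (E.incl 0 x)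

/-- `(O, C, E)` is a tame sc-smooth retract. -/
def IsTameRetract (C : PartialQuadrant E) (O : Set (E.lev 0)) : Prop :=
  ∃ (U : Set (E.lev 0)) (r : E.lev 0 → E.lev 0), IsTameRetraction C U r ∧ r '' U = O

/-- A map `f` from the sc-smooth retract `O` to `F` is sc-smooth: `f ∘ r : U → F` is sc-smooth for a
suitable sc-smooth retraction `r : U → U` with `r(U) = O`. -/
def ScSmoothOnRetract {F : ScBanach.{v}} (C : PartialQuadrant E) (f : E.lev 0 → F.lev 0)
    (O : Set (E.lev 0)) : Prop :=
  ∃ (U : Set (E.lev 0)) (r : E.lev 0 → E.lev 0), IsScRetraction C U r ∧ r '' U = O ∧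
    ScSmooth (f ∘ r) U

end Retracts

/-! ## M-polyfolds -/

/-- A homeomorphism `e` from an open subset of `X` to a subset (with the topology of `E = E_0`)
of an sc-Banach space `E` with a partial quadrant `C`. -/
structure ModelChart (X : Type u) [TopologicalSpace X] where
  E : ScBanach.{v}
  C : PartialQuadrant E
  e : PartialEquiv X (E.lev 0)
  open_source : IsOpen e.source
  continuousOn_toFun : ContinuousOn e e.source
  continuousOn_invFun : ContinuousOn e.symm e.target

namespace ModelChart

variable {X : Type u} [TopologicalSpace X]

/-- Sc-smoothness of the transition map `φ' ∘ φ⁻¹ : φ(U ∩ U') → φ'(U ∩ U')`. -/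
def SmoothTransition (c c' : ModelChart.{u, v} X) : Prop :=
  ScSmoothOnRetract c.C (c'.e ∘ c.e.symm) (c.e '' (c.e.source ∩ c'.e.source))

/-- The product `φ × ψ` of two charts. -/
noncomputable def prod {Z : Type w} [TopologicalSpace Z]
    (c : ModelChart.{u, v} X) (d : ModelChart.{w, z} Z) :
    ModelChart.{max u w, max v z} (X × Z) where
  E := c.E.prod d.E
  C := c.C.prod d.C
  e := c.e.prod d.e
  open_source := c.open_source.prod d.open_source
  continuousOn_toFun := c.continuousOn_toFun.prodMap d.continuousOn_toFun
  continuousOn_invFun := c.continuousOn_invFun.prodMap d.continuousOn_invFun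

end ModelChart

/-- An M-polyfold structure on the topological space `X`: `X` is Hausdorff and paracompact, and
carries an sc-smooth atlas, that is, a set of charts onto sc-smooth retracts `(O, C, E)` that
cover `X` and have sc-smooth transition maps.  Equivalent atlases (`MPolyfold.Equivalent`) represent
the same M-polyfold. -/
structure MPolyfold (X : Type u) [TopologicalSpace X] where
  t2 : T2Space X
  paracompact : ParacompactSpace X
  charts : Set (ModelChart.{u, v} X)
  retract : ∀ c ∈ charts, IsScRetract c.C c.e.target
  cover : ∀ x, ∃ c ∈ charts, x ∈ c.e.source
  compat : ∀ c ∈ charts, ∀ c' ∈ charts, c.SmoothTransition c'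

/-- The map `f : W → Z`, defined on the open subset `W` of `X`, is sc-smooth with respect to the
charts `A` of `X` and `B` of `Z`: it is continuous, and for all charts `φ` in `A` and `ψ` in `B`, the map
`ψ ∘ f ∘ φ⁻¹` is sc-smooth on the retract `φ(dom φ ∩ W ∩ f⁻¹(dom ψ))`. -/
def ScSmoothMapOn {X : Type u} [TopologicalSpace X] {Z : Type w} [TopologicalSpace Z]
    (A : Set (ModelChart.{u, v} X)) (B : Set (ModelChart.{w, z} Z)) (f : X → Z) (W : Set X) :
    Prop :=
  ContinuousOn f W ∧ ∀ c ∈ A, ∀ d ∈ B,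
    ScSmoothOnRetract c.C (d.e ∘ f ∘ c.e.symm) (c.e '' (c.e.source ∩ W ∩ f ⁻¹' d.e.source))

/-- The product atlas. -/
def prodCharts {X : Type u} [TopologicalSpace X] {Z : Type w} [TopologicalSpace Z]
    (A : Set (ModelChart.{u, v} X)) (B : Set (ModelChart.{w, z} Z)) :
    Set (ModelChart.{max u w, max v z} (X × Z)) :=
  {q | ∃ c ∈ A, ∃ d ∈ B, q = c.prod d}

namespace MPolyfold

section

variable {X : Type u} [TopologicalSpace X]

/-- Two atlases are equivalent: their union is an sc-smooth atlas. -/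
def Equivalent (S S' : MPolyfold.{u, v} X) : Prop :=
  ∀ c ∈ S.charts, ∀ c' ∈ S'.charts, c.SmoothTransition c' ∧ c'.SmoothTransition c

/-- `c` is an M-polyfold chart of `X`, sc-smoothly compatible with the given atlas. -/
def IsChart (S : MPolyfold.{u, v} X) (c : ModelChart.{u, v} X) : Prop :=
  IsScRetract c.C c.e.target ∧
    ∀ c' ∈ S.charts, c.SmoothTransition c' ∧ c'.SmoothTransition c

/-- The degeneracy index `d_X(x)`: the minimum of `d_C(φ(x))` over all charts `φ` around `x`. -/
noncomputable def degeneracy (S : MPolyfold.{u, v} X) (x : X) : ℕ :=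
  sInf {k | ∃ c : ModelChart.{u, v} X, S.IsChart c ∧ x ∈ c.e.source ∧
    c.C.degeneracy (c.e x) = k}

/-- `X` is a tame M-polyfold: it is metrizable and its structure is given by an atlas consisting of
charts onto tame retracts. -/
def IsTame (S : MPolyfold.{u, v} X) : Prop :=
  TopologicalSpace.MetrizableSpace X ∧
    ∃ S' : MPolyfold.{u, v} X, S.Equivalent S' ∧ ∀ c ∈ S'.charts, IsTameRetract c.C c.e.target

/-- `X` is a smooth finite-dimensional manifold with boundary with corners: its structure is given
by an atlas of charts onto relatively open subsets of partial quadrants in finite-dimensional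
spaces, with transition maps that are smooth in the classical sense. -/
def IsFiniteDimManifold (S : MPolyfold.{u, v} X) : Prop :=
  ∃ S' : MPolyfold.{u, v} X, S.Equivalent S' ∧
    (∀ c ∈ S'.charts, FiniteDimensional ℝ (c.E.lev 0) ∧ c.C.IsRelOpen c.e.target) ∧
    ∀ c ∈ S'.charts, ∀ c' ∈ S'.charts,
      ContDiffOn ℝ ∞ (c'.e ∘ c.e.symm) (c.e '' (c.e.source ∩ c'.e.source))

end

section

variable {X : Type u} [TopologicalSpace X] {Z : Type w} [TopologicalSpace Z]

/-- `f : W → Z` is sc-smooth, `W` an open subset of the M-polyfold `X`. -/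
def SmoothOn (S : MPolyfold.{u, v} X) (R : MPolyfold.{w, z} Z) (f : X → Z) (W : Set X) : Prop :=
  ScSmoothMapOn S.charts R.charts f W

/-- `f : X → Z` is an sc-smooth map between M-polyfolds. -/
def Smooth (S : MPolyfold.{u, v} X) (R : MPolyfold.{w, z} Z) (f : X → Z) : Prop :=
  S.SmoothOn R f univ

/-- The submersion property of `p : X → Z`: `p` is surjective, and around every point of the graph
of `p` there is an open subset `U` of `X × Z` with an sc-smooth retraction `ρ : U → U` of the form
`ρ(x, z) = (ρ̄(x, z), z)` with `ρ(U) = U ∩ Gr(p)`. -/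
def HasSubmersionProperty (S : MPolyfold.{u, v} X) (R : MPolyfold.{w, z} Z) (p : X → Z) : Prop :=
  Function.Surjective p ∧
    ∀ x₀ : X, ∃ U : Set (X × Z), IsOpen U ∧ (x₀, p x₀) ∈ U ∧
      ∃ ρ : X × Z → X × Z, MapsTo ρ U U ∧
        ScSmoothMapOn (prodCharts S.charts R.charts) (prodCharts S.charts R.charts) ρ U ∧
        (∀ q ∈ U, (ρ q).2 = q.2) ∧ (∀ q ∈ U, ρ (ρ q) = ρ q) ∧
        ρ '' U = U ∩ {q | p q.1 = q.2}

/-- `oplus : X → Y` is an imprinting: it is surjective, `Y` carries the quotient topology, this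
topology is metrizable, and around every point of `Y` there is an open `V` with a map `H : V → X`
such that `oplus ∘ H = Id` on `V` and `H ∘ oplus : oplus⁻¹(V) → X` is sc-smooth. -/
def IsImprinting (S : MPolyfold.{u, v} X) {Y : Type w} [TopologicalSpace Y] (oplus : X → Y) :
    Prop :=
  IsQuotientMap oplus ∧ TopologicalSpace.MetrizableSpace Y ∧
    ∀ y : Y, ∃ V : Set Y, IsOpen V ∧ y ∈ V ∧ ∃ H : Y → X,
      (∀ y' ∈ V, oplus (H y') = y') ∧ S.SmoothOn S (H ∘ oplus) (oplus ⁻¹' V)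

/-- `R` is an M-polyfold structure on `Y` induced by `oplus : X → Y`: the map `oplus` is sc-smooth,
and around every point of `Y` it has a local sc-smooth section. -/
def IsInducedBy (R : MPolyfold.{w, v} Z) (S : MPolyfold.{u, v} X) (oplus : X → Z) : Prop :=
  S.Smooth R oplus ∧
    ∀ y : Z, ∃ V : Set Z, IsOpen V ∧ y ∈ V ∧ ∃ H : Z → X,
      (∀ y' ∈ V, oplus (H y') = y') ∧ R.SmoothOn S H V

end

end MPolyfold

-- Smoothness is handled through plots: continuous maps into a space, in practice from an sc-domain,
-- that are sc-smooth in all charts. Sc-smooth maps carry plots to plots (`IsPlot.map`), and a map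
-- doing so is sc-smooth (`IsScAtlas.scSmoothMapOn`); composition, products and change of atlas thus
-- become formal. The analytic input is the chain rule `HasScDerivAt.comp`, which rests on the
-- compactness of the inclusion of E_1 in E_0.
--
-- A chart φ of X with retraction r, together with a local section H, gives the chart φ ∘ H of Y.
-- Its image is that of the retraction T = φ ∘ H ∘ ⊕ ∘ φ⁻¹ ∘ r. Two induced structures have the same
-- plots, because a plot α is locally ⊕ ∘ (H ∘ α). The submersion property descends by conjugating ρ
-- with H and ⊕.
--
-- The core is the tameness of T (`IsImprintingSection.isTameRetraction`). Since p ∘ H ∘ ⊕ = p and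
-- d_V ∘ p = d_X, the map T preserves d_C. At a smooth fixed point x of T put P = Dr(x) and Q =
-- DT(x); then PQ = QP = Q. If A ⊆ E_x complements the range of P, then (P - Q)E ⊕ A complements the
-- range of Q (`exists_scComplement`), and it remains to see that (P - Q)E ⊆ E_x. Let L be the
-- differential of p in charts. From LP = L = LQ follows (P - Q)E ⊆ ker L. The submersion property
-- makes L surjective (`MPolyfold.HasSubmersionProperty.surjective_scDeriv`), and L respects the
-- face planes (`HasScDerivAt.mapsTo_facePlane`). It therefore induces a surjection between the
-- quotients by these planes. Their dimensions are d_X and d_V, which agree, so the surjection is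
-- injective and ker L ⊆ E_x (`PartialQuadrant.mem_facePlane_of_surjective`).
--
-- All this uses that the minimum defining the degeneracy index is attained in every tame chart
-- (`MPolyfold.IsChart.degeneracy_eq`). A transition map and its inverse are differentiated at a
-- smooth point and compared modulo face planes; the general point follows by approximation.

universe u₁ u₂ u₃ u₄ u₅ u₆ u₇

/-! ## Levels of an sc-Banach space -/

namespace ScBanach

theorem incl_denseRange (E : ScBanach.{u₁}) (i : ℕ) : DenseRange (E.incl i) :=
  (E.dense_smooth i).mono (by rintro x ⟨s, hs, rfl⟩; exact ⟨s (i + 1), hs i⟩)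

theorem toZero_injective (E : ScBanach.{u₁}) : ∀ i, Function.Injective (E.toZero i)
  | 0 => fun _ _ h => h
  | i + 1 => (E.toZero_injective i).comp (E.incl_injective i)

/-- The inclusion `E_{i+1} → E_1`. -/
noncomputable def toOne (E : ScBanach.{u₁}) : ∀ i, E.lev (i + 1) →L[ℝ] E.lev 1
  | 0 => ContinuousLinearMap.id ℝ (E.lev 1)
  | i + 1 => (E.toOne i).comp (E.incl (i + 1))

theorem tangent_toZero (E : ScBanach.{u₁}) : ∀ (i : ℕ) (z : E.lev (i + 1) × E.lev i),
    E.tangent.toZero i z = (E.toOne i z.1, E.toZero i z.2)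
  | 0, _ => rfl
  | i + 1, z => E.tangent_toZero i (E.incl (i + 1) z.1, E.incl i z.2)

theorem prod_toZero (E : ScBanach.{u₁}) (F : ScBanach.{u₂}) : ∀ (i : ℕ) (z : E.lev i × F.lev i),
    (E.prod F).toZero i z = (E.toZero i z.1, F.toZero i z.2)
  | 0, _ => rfl
  | i + 1, z => prod_toZero E F i (E.incl i z.1, F.incl i z.2)

end ScBanach

/-! ## Domains with a well-behaved differential calculus -/

section Domains

variable {E : ScBanach.{u₁}} {F : ScBanach.{u₂}}

/-- Intersections of an open set with a convex set that has interior points. -/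
def IsScDomain {A : Type*} [NormedAddCommGroup A] [NormedSpace ℝ A] (U : Set A) : Prop :=
  ∃ G K : Set A, IsOpen G ∧ Convex ℝ K ∧ (interior K).Nonempty ∧ U = G ∩ K

theorem IsScDomain.univ {A : Type*} [NormedAddCommGroup A] [NormedSpace ℝ A] :
    IsScDomain (univ : Set A) :=
  ⟨Set.univ, Set.univ, isOpen_univ, convex_univ, by simp, by simp⟩

theorem IsScDomain.inter_open {A : Type*} [NormedAddCommGroup A] [NormedSpace ℝ A]
    {U G : Set A} (hU : IsScDomain U) (hG : IsOpen G) : IsScDomain (U ∩ G) := by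
  obtain ⟨G', K, hG', hK, hi, rfl⟩ := hU
  exact ⟨G' ∩ G, K, hG'.inter hG, hK, hi, by ac_rfl⟩

/-- A dense range meets the interior of the convex set, so the preimage of that set still has
interior points. This lets sc-domains pass to higher levels. -/
theorem IsScDomain.preimage {A B : Type*} [NormedAddCommGroup A] [NormedSpace ℝ A]
    [NormedAddCommGroup B] [NormedSpace ℝ B] {U : Set A} (hU : IsScDomain U) (L : B →L[ℝ] A)
    (hL : DenseRange L) : IsScDomain (L ⁻¹' U) := by
  obtain ⟨G, K, hG, hK, hi, rfl⟩ := hU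
  refine ⟨L ⁻¹' G, L ⁻¹' K, hG.preimage L.continuous, hK.linear_preimage L.toLinearMap, ?_, rfl⟩
  obtain ⟨b, hb⟩ := hL.exists_mem_open isOpen_interior hi
  exact ⟨b, interior_maximal (preimage_mono interior_subset)
    (isOpen_interior.preimage L.continuous) hb⟩

theorem IsScDomain.uniqueDiffOn {A : Type*} [NormedAddCommGroup A] [NormedSpace ℝ A]
    {U : Set A} (hU : IsScDomain U) : UniqueDiffOn ℝ U := by
  obtain ⟨G, K, hG, hK, hi, rfl⟩ := hU
  rw [inter_comm]
  exact (uniqueDiffOn_convex hK hi).inter hG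

theorem IsScDomain.tangent {U : Set (E.lev 0)} (hU : IsScDomain U) :
    IsScDomain (A := E.tangent.lev 0) {z : E.lev 1 × E.lev 0 | E.incl 0 z.1 ∈ U} := by
  refine hU.preimage (B := E.tangent.lev 0)
    ((E.incl 0).comp (ContinuousLinearMap.fst ℝ (E.lev 1) (E.lev 0))) ?_
  exact (E.incl_denseRange 0).comp Prod.fst_surjective.denseRange (E.incl 0).continuous

/-- The limit only determines the operator on vectors of E_1; continuity and the density of E_1 in
E_0 do the rest. -/
theorem HasScDerivAt.unique {f : E.lev 0 → F.lev 0} {U : Set (E.lev 0)} {x : E.lev 1}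
    {D D' : E.lev 0 →L[ℝ] F.lev 0} (hU : IsScDomain U) (hx : E.incl 0 x ∈ U)
    (h : HasScDerivAt f U x D) (h' : HasScDerivAt f U x D') : D = D' := by
  have hu := (hU.preimage (E.incl 0) (E.incl_denseRange 0)).uniqueDiffOn x hx
  have he : D.comp (E.incl 0) = D'.comp (E.incl 0) := hu.eq h h'
  have : (D : E.lev 0 → F.lev 0) = D' :=
    (E.incl_denseRange 0).equalizer D.continuous D'.continuous
      (funext fun _ => DFunLike.congr_fun he _)
  exact DFunLike.coe_injective this

theorem HasScDerivAt.mono {f : E.lev 0 → F.lev 0} {U U' : Set (E.lev 0)} {x : E.lev 1}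
    {D : E.lev 0 →L[ℝ] F.lev 0} (h : HasScDerivAt f U x D) (hU : U' ⊆ U) :
    HasScDerivAt f U' x D :=
  HasFDerivWithinAt.mono h (preimage_mono hU)

theorem HasScDerivAt.congr {f g : E.lev 0 → F.lev 0} {U : Set (E.lev 0)} {x : E.lev 1}
    {D : E.lev 0 →L[ℝ] F.lev 0} (h : HasScDerivAt f U x D) (hfg : EqOn g f U)
    (hx : E.incl 0 x ∈ U) : HasScDerivAt g U x D :=
  HasFDerivWithinAt.congr h (fun _ hy => hfg hy) (hfg hx)

theorem HasScDerivAt.of_inter {f : E.lev 0 → F.lev 0} {U G : Set (E.lev 0)} {x : E.lev 1}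
    {D : E.lev 0 →L[ℝ] F.lev 0} (h : HasScDerivAt f (U ∩ G) x D) (hG : IsOpen G)
    (hx : E.incl 0 x ∈ G) : HasScDerivAt f U x D :=
  (hasFDerivWithinAt_inter ((hG.preimage (E.incl 0).continuous).mem_nhds hx)).1 h

end Domains

/-! ## Sc-continuity -/

section ScContinuity

variable {E : ScBanach.{u₁}} {F : ScBanach.{u₂}} {G : ScBanach.{u₃}}
  {f g : E.lev 0 → F.lev 0} {U U' : Set (E.lev 0)}

theorem ScCont.continuousOn (h : ScCont f U) : ContinuousOn f U := by
  obtain ⟨g, hg, hgf⟩ := h 0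
  exact hg.congr fun x hx => (hgf x hx).symm

theorem ScCont.mono (h : ScCont f U) (hU : U' ⊆ U) : ScCont f U' := fun i => by
  obtain ⟨g, hg, hgf⟩ := h i
  exact ⟨g, hg.mono (preimage_mono hU), fun x hx => hgf x (hU hx)⟩

theorem ScCont.congr (h : ScCont f U) (hfg : EqOn g f U) : ScCont g U := fun i => by
  obtain ⟨g', hg, hgf⟩ := h i
  exact ⟨g', hg, fun x hx => (hgf x hx).trans (hfg hx).symm⟩

theorem ScCont.comp {g : F.lev 0 → G.lev 0} {V : Set (F.lev 0)} (hg : ScCont g V)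
    (hf : ScCont f U) (hm : MapsTo f U V) : ScCont (g ∘ f) U := fun i => by
  obtain ⟨f', hf', hff⟩ := hf i
  obtain ⟨g', hg', hgg⟩ := hg i
  have hm' : MapsTo f' (E.levelSet U i) (F.levelSet V i) := fun x hx => by
    change F.toZero i (f' x) ∈ V
    rw [hff x hx]; exact hm hx
  exact ⟨g' ∘ f', hg'.comp hf' hm', fun x hx => by
    rw [Function.comp_apply, hgg _ (hm' hx), hff x hx]; rfl⟩

/-- Lifts to level i are unique by injectivity of `toZero`, so local lifts agree and glue. -/
theorem ScCont.of_local
    (h : ∀ x ∈ U, ∃ G : Set (E.lev 0), IsOpen G ∧ x ∈ G ∧ ScCont f (U ∩ G)) : ScCont f U := by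
  intro i
  have h' : ∀ x : E.lev i, ∃ y : F.lev i, x ∈ E.levelSet U i →
      F.toZero i y = f (E.toZero i x) := fun x => by
    by_cases hx : x ∈ E.levelSet U i
    · obtain ⟨G, -, hxG, hG⟩ := h _ hx
      obtain ⟨g, -, hg⟩ := hG i
      exact ⟨g x, fun _ => hg x ⟨hx, hxG⟩⟩
    -- Outside the domain the lift is arbitrary.
    · exact ⟨0, fun hx' => absurd hx' hx⟩
  choose g hg using h'
  refine ⟨g, fun x hx => ?_, hg⟩
  obtain ⟨G, hG, hxG, hfG⟩ := h _ hx
  obtain ⟨g', hg', hgf⟩ := hfG i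
  have hn : E.toZero i ⁻¹' G ∈ 𝓝 x := (hG.preimage (E.toZero i).continuous).mem_nhds hxG
  refine (continuousWithinAt_inter hn).1 ?_
  have he : ∀ y ∈ E.levelSet U i ∩ E.toZero i ⁻¹' G, g y = g' y := fun y hy =>
    F.toZero_injective i ((hg y hy.1).trans (hgf y hy).symm)
  exact (hg' x ⟨hx, hxG⟩).congr he (he x ⟨hx, hxG⟩)

end ScContinuity

/-! ## Maps of class sc^k -/

section ScDifferentiability

variable {E : ScBanach.{u₁}} {F : ScBanach.{u₂}} {G : ScBanach.{u₃}}
  {f g : E.lev 0 → F.lev 0} {U U' : Set (E.lev 0)} {k : ℕ}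

theorem scDiff_succ : ScDiff (k + 1) f U ↔ ScCont f U ∧
    ∃ (f₁ : E.lev 1 → F.lev 1) (D : E.lev 1 → E.lev 0 →L[ℝ] F.lev 0),
      (∀ x ∈ E.incl 0 ⁻¹' U, F.incl 0 (f₁ x) = f (E.incl 0 x) ∧ HasScDerivAt f U x (D x)) ∧
      ScDiff k (E := E.tangent) (F := F.tangent)
        (fun z : E.lev 1 × E.lev 0 => ((f₁ z.1, D z.1 z.2) : F.lev 1 × F.lev 0))
        {z : E.lev 1 × E.lev 0 | E.incl 0 z.1 ∈ U} := Iff.rfl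

theorem ScDiff.scCont (h : ScDiff k f U) : ScCont f U := by
  cases k with
  | zero => exact h
  | succ k => exact h.1

theorem ScDiff.congr (h : ScDiff k f U) (hfg : EqOn g f U) : ScDiff k g U := by
  cases k with
  | zero => exact ScCont.congr h hfg
  | succ k =>
    obtain ⟨hc, f₁, D, hD, hT⟩ := h
    exact ⟨hc.congr hfg, f₁, D,
      fun x hx => ⟨(hD x hx).1.trans (hfg hx).symm, (hD x hx).2.congr hfg hx⟩, hT⟩

theorem ScDiff.mono (h : ScDiff k f U) (hU : U' ⊆ U) : ScDiff k f U' := by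
  induction k generalizing E F with
  | zero => exact ScCont.mono h hU
  | succ k ih =>
    obtain ⟨hc, f₁, D, hD, hT⟩ := h
    exact ⟨hc.mono hU, f₁, D, fun x hx => ⟨(hD x (hU hx)).1, (hD x (hU hx)).2.mono hU⟩,
      ih hT fun z hz => hU hz⟩

/-- The local tangent maps glue because lifts and sc-derivatives are unique. Uniqueness of the
derivative is what requires an sc-domain, and `IsScDomain.tangent` keeps the induction going. -/
theorem ScDiff.of_local (hU : IsScDomain U)
    (h : ∀ x ∈ U, ∃ G : Set (E.lev 0), IsOpen G ∧ x ∈ G ∧ ScDiff k f (U ∩ G)) :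
    ScDiff k f U := by
  induction k generalizing E F with
  | zero => exact ScCont.of_local h
  | succ k ih =>
    refine ⟨ScCont.of_local fun x hx => ?_, ?_⟩
    · obtain ⟨G, hG, hxG, hf⟩ := h x hx
      exact ⟨G, hG, hxG, hf.scCont⟩
    choose! N hN hxN hf using h
    simp only [scDiff_succ] at hf
    choose! hc f₁ D hD hT using hf
    -- Diagonal choice: at each point the data of the neighbourhood attached to that very point are
    -- used.
    refine ⟨fun x => f₁ (E.incl 0 x) x, fun x => D (E.incl 0 x) x, fun x hx => ?_, ?_⟩
    · have hx' : x ∈ E.incl 0 ⁻¹' (U ∩ N (E.incl 0 x)) := ⟨hx, hxN _ hx⟩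
      exact ⟨(hD _ hx x hx').1, (hD _ hx x hx').2.of_inter (hN _ hx) (hxN _ hx)⟩
    · refine ih hU.tangent fun z hz => ?_
      have hz' : E.incl 0 z.1 ∈ U := hz
      refine ⟨{y : E.lev 1 × E.lev 0 | E.incl 0 y.1 ∈ N (E.incl 0 z.1)},
        (hN _ hz').preimage ((E.incl 0).continuous.comp continuous_fst), hxN _ hz', ?_⟩
      refine ScDiff.congr (hT _ hz') ?_
      rintro y ⟨hy, hyN⟩
      have hyU : E.incl 0 y.1 ∈ U := hy
      have hyN' : E.incl 0 y.1 ∈ N (E.incl 0 z.1) := hyN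
      have h1 := hD _ hz' y.1 ⟨hyU, hyN'⟩
      have h2 := hD _ hyU y.1 ⟨hyU, hxN _ hyU⟩
      have e1 : f₁ (E.incl 0 y.1) y.1 = f₁ (E.incl 0 z.1) y.1 :=
        F.incl_injective 0 (h2.1.trans h1.1.symm)
      have e2 : D (E.incl 0 y.1) y.1 = D (E.incl 0 z.1) y.1 :=
        HasScDerivAt.unique hU hyU (h2.2.of_inter (hN _ hyU) (hxN _ hyU))
          (h1.2.of_inter (hN _ hz') hyN')
      change ((f₁ (E.incl 0 y.1) y.1, D (E.incl 0 y.1) y.1 y.2) : F.lev 1 × F.lev 0) = _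
      rw [e1, e2]

end ScDifferentiability

/-! ## The chain rule -/

section ChainRule

variable {E : ScBanach.{u₁}} {F : ScBanach.{u₂}} {G : ScBanach.{u₃}}

/-- A continuous family of operators is uniformly close to its value at a point on a neighbourhood
of a compact set. -/
theorem exists_thickening_norm_sub_le {A B C : Type*} [TopologicalSpace A]
    [NormedAddCommGroup B] [NormedSpace ℝ B] [NormedAddCommGroup C] [NormedSpace ℝ C]
    {T : A → B →L[ℝ] C} {S : Set A} {a : A} (ha : a ∈ S)
    (hT : ContinuousOn (fun z : A × B => T z.1 z.2) (S ×ˢ univ)) {K : Set B} (hK : IsCompact K)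
    {ε : ℝ} (hε : 0 < ε) :
    ∃ N ∈ 𝓝 a, ∃ δ > 0, ∀ x ∈ N ∩ S, ∀ b ∈ Metric.thickening δ K, ‖T x b - T a b‖ ≤ ε := by
  -- Tube lemma: the family is only jointly continuous, not continuous in operator norm, and
  -- compactness of `K` supplies the uniformity.
  have h : {q : A × B | ‖T q.1 q.2 - T a q.2‖ ≤ ε} ∈ 𝓝[S] a ×ˢ 𝓝ˢ K := by
    refine hK.mem_prod_nhdsSet_of_forall fun b _ => ?_
    have h1 : Tendsto (fun q : A × B => T q.1 q.2) (𝓝[S] a ×ˢ 𝓝 b) (𝓝 (T a b)) := by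
      have := hT (a, b) ⟨ha, mem_univ b⟩
      rwa [ContinuousWithinAt, nhdsWithin_prod_eq, nhdsWithin_univ] at this
    have h2 : Tendsto (fun q : A × B => T a q.2) (𝓝[S] a ×ˢ 𝓝 b) (𝓝 (T a b)) :=
      ((T a).continuous.tendsto b).comp tendsto_snd
    have h3 := (h1.sub h2).norm
    rw [sub_self, norm_zero] at h3
    exact h3.eventually (ge_mem_nhds hε)
  obtain ⟨s, hs, t, ht, hst⟩ := mem_prod_iff.1 h
  obtain ⟨N, hN, hNs⟩ := mem_nhdsWithin_iff_exists_mem_nhds_inter.1 hs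
  obtain ⟨δ, hδ, hδt⟩ := (Metric.hasBasis_nhdsSet_thickening hK).mem_iff.1 ht
  exact ⟨N, hN, δ, hδ, fun x hx b hb => hst (show (x, b) ∈ s ×ˢ t from ⟨hNs hx, hδt hb⟩)⟩

/-- The mean value inequality along a segment in the level `1`. -/
theorem norm_sub_sub_le_of_hasScDerivAt {g : F.lev 0 → G.lev 0} {V : Set (F.lev 0)}
    {Dg : F.lev 1 → F.lev 0 →L[ℝ] G.lev 0} {M : Set (F.lev 1)} (hM : Convex ℝ M)
    (hMV : M ⊆ F.incl 0 ⁻¹' V) (hg : ∀ y ∈ M, HasScDerivAt g V y (Dg y))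
    {a b : F.lev 1} (ha : a ∈ M) (hb : b ∈ M) (A : F.lev 0 →L[ℝ] G.lev 0) {c : ℝ}
    (hc : ∀ y ∈ M, ‖Dg y (F.incl 0 (b - a)) - A (F.incl 0 (b - a))‖ ≤ c) :
    ‖g (F.incl 0 b) - g (F.incl 0 a) - A (F.incl 0 (b - a))‖ ≤ c := by
  have hz : ∀ t ∈ Icc (0 : ℝ) 1, a + t • (b - a) ∈ M := fun t ht =>
    hM.add_smul_sub_mem ha hb ht
  have hd : ∀ t ∈ Icc (0 : ℝ) 1, HasDerivWithinAt
      (fun t : ℝ => g (F.incl 0 (a + t • (b - a))) - t • A (F.incl 0 (b - a)))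
      (Dg (a + t • (b - a)) (F.incl 0 (b - a)) - A (F.incl 0 (b - a))) (Icc 0 1) t := by
    intro t ht
    have h1 : HasDerivWithinAt (fun t : ℝ => a + t • (b - a)) (b - a) (Icc 0 1) t := by
      simpa using (((hasDerivAt_id t).smul_const (b - a)).const_add a).hasDerivWithinAt
    have h2 : HasFDerivWithinAt (fun y : F.lev 1 => g (F.incl 0 y))
      ((Dg (a + t • (b - a))).comp (F.incl 0)) (F.incl 0 ⁻¹' V) (a + t • (b - a)) := hg _ (hz t ht)
    have h3 := h2.comp_hasDerivWithinAt t h1 fun s hs => hMV (hz s hs)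
    have h4 : HasDerivWithinAt (fun t : ℝ => t • A (F.incl 0 (b - a)))
        (A (F.incl 0 (b - a))) (Icc 0 1) t := by
      simpa using ((hasDerivAt_id t).smul_const (A (F.incl 0 (b - a)))).hasDerivWithinAt
    exact h3.sub h4
  have := norm_image_sub_le_of_norm_deriv_le_segment_01' hd
    (fun t ht => hc _ (hz t ⟨ht.1, ht.2.le⟩))
  simpa [sub_right_comm] using this

/-- The chain rule for the sc-derivative. -/
theorem HasScDerivAt.comp {f : E.lev 0 → F.lev 0} {U : Set (E.lev 0)} {x : E.lev 1}
    {D : E.lev 0 →L[ℝ] F.lev 0} (hf : HasScDerivAt f U x D) (hx : E.incl 0 x ∈ U)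
    {f₁ : E.lev 1 → F.lev 1} (hf₁ : ContinuousWithinAt f₁ (E.incl 0 ⁻¹' U) x)
    (hff : ∀ y ∈ E.incl 0 ⁻¹' U, F.incl 0 (f₁ y) = f (E.incl 0 y))
    {g : F.lev 0 → G.lev 0} {V : Set (F.lev 0)} (hV : IsScDomain V) (hm : MapsTo f U V)
    {Dg : F.lev 1 → F.lev 0 →L[ℝ] G.lev 0}
    (hg : ∀ y ∈ F.incl 0 ⁻¹' V, HasScDerivAt g V y (Dg y))
    (hDg : ContinuousOn (fun z : F.lev 1 × F.lev 0 => Dg z.1 z.2) ((F.incl 0 ⁻¹' V) ×ˢ univ)) :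
    HasScDerivAt (g ∘ f) U x ((Dg (f₁ x)).comp D) := by
  obtain ⟨N₀, K₀, hN₀, hK₀, -, rfl⟩ := hV
  have hV₁ : ∀ y ∈ E.incl 0 ⁻¹' U, f₁ y ∈ F.incl 0 ⁻¹' (N₀ ∩ K₀) := fun y hy => by
    change F.incl 0 (f₁ y) ∈ N₀ ∩ K₀
    rw [hff y hy]; exact hm hy
  set A := Dg (f₁ x) with hA
  -- Here the compactness of the inclusion of E_1 in E_0 enters: normalized first-order increments
  -- of f stay in a compact set.
  have hcpt : IsCompact (closure ((fun v => D (E.incl 0 v)) '' Metric.closedBall 0 1)) := by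
    have h1 := (E.incl_compact 0).clm_comp D
    exact IsCompactOperator.isCompact_closure_image_closedBall (𝕜₁ := ℝ)
      (f := (D.comp (E.incl 0)).toLinearMap) h1 1
  have hf' : HasFDerivWithinAt (fun y : E.lev 1 => f (E.incl 0 y)) (D.comp (E.incl 0))
    (E.incl 0 ⁻¹' U) x := hf
  have hlin := hf'.isLittleO
  change HasFDerivWithinAt (fun y : E.lev 1 => g (f (E.incl 0 y))) ((A.comp D).comp (E.incl 0))
    (E.incl 0 ⁻¹' U) x
  refine HasFDerivWithinAt.of_isLittleO ?_
  -- The error splits into A applied to the error of f, treated here, and the error of g along the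
  -- increment of f, which is `hmain`.
  have hlin2 : (fun y => A (f (E.incl 0 y) - f (E.incl 0 x) - (D.comp (E.incl 0)) (y - x)))
      =o[𝓝[E.incl 0 ⁻¹' U] x] fun y => y - x :=
    (A.isBigO_comp _ _).trans_isLittleO hlin
  have hmain : (fun y => g (f (E.incl 0 y)) - g (f (E.incl 0 x))
      - A (f (E.incl 0 y) - f (E.incl 0 x))) =o[𝓝[E.incl 0 ⁻¹' U] x] fun y => y - x := by
    rw [Asymptotics.isLittleO_iff]
    intro ε hε
    obtain ⟨N, hN, δ, hδ, hNδ⟩ := exists_thickening_norm_sub_le (hV₁ x hx) hDg hcpt hε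
    have hN' : N ∩ F.incl 0 ⁻¹' N₀ ∈ 𝓝 (f₁ x) :=
      inter_mem hN ((hN₀.preimage (F.incl 0).continuous).mem_nhds (hV₁ x hx).1)
    obtain ⟨η, hη, hηN⟩ := Metric.mem_nhds_iff.1 hN'
    have hball := hf₁ (Metric.ball_mem_nhds (f₁ x) hη)
    filter_upwards [hball, (Asymptotics.isLittleO_iff.1 hlin) (half_pos hδ),
      self_mem_nhdsWithin] with y hy hyδ hyU
    rcases eq_or_ne y x with rfl | hyx
    · simp
    have hl : 0 < ‖y - x‖ := norm_pos_iff.2 (sub_ne_zero.2 hyx)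
    -- A convex subset of the level-1 domain containing f₁ x and f₁ y, so that the mean value
    -- inequality applies on the segment between them.
    set M : Set (F.lev 1) := Metric.ball (f₁ x) η ∩ F.incl 0 ⁻¹' K₀ with hMdef
    have hMc : Convex ℝ M :=
      (convex_ball _ _).inter (hK₀.linear_preimage (F.incl 0).toLinearMap)
    have hMV : M ⊆ F.incl 0 ⁻¹' (N₀ ∩ K₀) := fun m hm => ⟨(hηN hm.1).2, hm.2⟩
    have hw : F.incl 0 (f₁ y - f₁ x) = f (E.incl 0 y) - f (E.incl 0 x) := by
      rw [map_sub, hff y hyU, hff x hx]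
    set w := f (E.incl 0 y) - f (E.incl 0 x) with hwdef
    -- Differentiability of f puts the normalized increment within δ of the compact set, where Dg is
    -- uniformly close to A.
    have hth : ‖y - x‖⁻¹ • w ∈ Metric.thickening δ
        (closure ((fun v => D (E.incl 0 v)) '' Metric.closedBall 0 1)) := by
      rw [Metric.mem_thickening_iff]
      refine ⟨D (E.incl 0 (‖y - x‖⁻¹ • (y - x))), subset_closure ⟨_, ?_, rfl⟩, ?_⟩
      · rw [mem_closedBall_zero_iff, norm_smul, norm_inv, norm_norm, inv_mul_cancel₀ hl.ne']
      · rw [dist_eq_norm, map_smul, map_smul, ← smul_sub, norm_smul, norm_inv, norm_norm,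
          inv_mul_lt_iff₀ hl]
        refine hyδ.trans_lt ?_
        rw [mul_comm]
        exact mul_lt_mul_of_pos_left (half_lt_self hδ) hl
    have key : ∀ m ∈ M, ‖Dg m (F.incl 0 (f₁ y - f₁ x)) - A (F.incl 0 (f₁ y - f₁ x))‖
        ≤ ε * ‖y - x‖ := by
      intro m hmM
      have h1 := hNδ m ⟨(hηN hmM.1).1, hMV hmM⟩ _ hth
      rw [map_smul, map_smul, ← smul_sub, norm_smul, norm_inv, norm_norm,
        inv_mul_le_iff₀ hl] at h1
      rw [hw]
      linarith
    have hres := norm_sub_sub_le_of_hasScDerivAt hMc hMV (fun m hm => hg m (hMV hm))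
      (a := f₁ x) (b := f₁ y) ⟨Metric.mem_ball_self hη, (hV₁ x hx).2⟩ ⟨hy, (hV₁ y hyU).2⟩ A key
    rwa [hw, hff y hyU, hff x hx] at hres
  refine (hmain.add hlin2).congr_left fun y => ?_
  simp only [map_sub, ContinuousLinearMap.comp_apply]
  abel

/-- Induction through T(g ∘ f) = Tg ∘ Tf; sc-continuity of the two tangent maps provides the
continuity assumptions of the pointwise chain rule. -/
theorem ScDiff.comp {k : ℕ} {f : E.lev 0 → F.lev 0} {U : Set (E.lev 0)}
    {g : F.lev 0 → G.lev 0} {V : Set (F.lev 0)} (hg : ScDiff k g V) (hf : ScDiff k f U)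
    (hV : IsScDomain V) (hm : MapsTo f U V) : ScDiff k (g ∘ f) U := by
  induction k generalizing E F G with
  | zero => exact ScCont.comp hg hf hm
  | succ k ih =>
    obtain ⟨hfc, f₁, Df, hDf, hTf⟩ := hf
    obtain ⟨hgc, g₁, Dg, hDg, hTg⟩ := hg
    have hm₁ : ∀ y ∈ E.incl 0 ⁻¹' U, F.incl 0 (f₁ y) ∈ V := fun y hy => by
      rw [(hDf y hy).1]; exact hm hy
    refine ⟨hgc.comp hfc hm, g₁ ∘ f₁, fun x => (Dg (f₁ x)).comp (Df x), fun x hx => ⟨?_, ?_⟩, ?_⟩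
    · rw [Function.comp_apply, (hDg _ (hm₁ x hx)).1, (hDf x hx).1]; rfl
    · have hcf : ContinuousOn (fun z : E.lev 1 × E.lev 0 => (f₁ z.1, Df z.1 z.2))
          {z : E.lev 1 × E.lev 0 | E.incl 0 z.1 ∈ U} := hTf.scCont.continuousOn
      have hcg : ContinuousOn (fun z : F.lev 1 × F.lev 0 => (g₁ z.1, Dg z.1 z.2))
          {z : F.lev 1 × F.lev 0 | F.incl 0 z.1 ∈ V} := hTg.scCont.continuousOn
      have hcf₁ : ContinuousOn f₁ (E.incl 0 ⁻¹' U) :=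
        (continuous_fst.comp_continuousOn hcf).comp
          (f := fun x => ((x, 0) : E.lev 1 × E.lev 0)) (by fun_prop) fun x hx => hx
      exact (hDf x hx).2.comp hx (hcf₁ x hx) (fun y hy => (hDf y hy).1) hV hm
        (fun y hy => (hDg y hy).2)
        ((continuous_snd.comp_continuousOn hcg).mono fun z hz => hz.1)
    · exact ih (E := E.tangent) (F := F.tangent) (G := G.tangent)
        (f := fun z : E.lev 1 × E.lev 0 => (f₁ z.1, Df z.1 z.2))
        (g := fun z : F.lev 1 × F.lev 0 => (g₁ z.1, Dg z.1 z.2)) hTg hTf hV.tangent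
        fun z hz => hm₁ z.1 hz

end ChainRule

/-! ## Sc-operators -/

/-- A family of bounded operators `E_i → F_i` compatible with the inclusions. -/
structure ScOp (E : ScBanach.{u₁}) (F : ScBanach.{u₂}) where
  map : ∀ i, E.lev i →L[ℝ] F.lev i
  comm : ∀ i (x : E.lev (i + 1)), F.incl i (map (i + 1) x) = map i (E.incl i x)

namespace ScOp

variable {E : ScBanach.{u₁}} {F : ScBanach.{u₂}}

theorem toZero_map (L : ScOp E F) :
    ∀ (i : ℕ) (x : E.lev i), F.toZero i (L.map i x) = L.map 0 (E.toZero i x)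
  | 0, _ => rfl
  | i + 1, x => by
    change F.toZero i (F.incl i _) = _
    rw [L.comm, L.toZero_map i]; rfl

theorem scCont (L : ScOp E F) (U : Set (E.lev 0)) : ScCont (L.map 0) U := fun i =>
  ⟨L.map i, (L.map i).continuous.continuousOn, fun x _ => L.toZero_map i x⟩

/-- The tangent map of an sc-operator. -/
noncomputable def tangent (L : ScOp E F) : ScOp E.tangent F.tangent where
  map i := (L.map (i + 1)).prodMap (L.map i)
  comm i x := Prod.ext (L.comm (i + 1) x.1) (L.comm i x.2)

theorem hasScDerivAt (L : ScOp E F) (U : Set (E.lev 0)) (x : E.lev 1) :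
    HasScDerivAt (L.map 0) U x (L.map 0) :=
  ((L.map 0).comp (E.incl 0)).hasFDerivWithinAt

theorem scDiff (L : ScOp E F) (U : Set (E.lev 0)) (k : ℕ) : ScDiff k (L.map 0) U := by
  induction k generalizing E F with
  | zero => exact L.scCont U
  | succ k ih =>
    exact ⟨L.scCont U, L.map 1, fun _ => L.map 0,
      fun x _ => ⟨L.comm 0 x, L.hasScDerivAt U x⟩, ih L.tangent _⟩

theorem scSmooth (L : ScOp E F) (U : Set (E.lev 0)) : ScSmooth (L.map 0) U := L.scDiff U

noncomputable def id (E : ScBanach.{u₁}) : ScOp E E where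
  map i := ContinuousLinearMap.id ℝ (E.lev i)
  comm _ _ := rfl

noncomputable def fst (E : ScBanach.{u₁}) (F : ScBanach.{u₂}) : ScOp (E.prod F) E where
  map i := ContinuousLinearMap.fst ℝ (E.lev i) (F.lev i)
  comm _ _ := rfl

noncomputable def snd (E : ScBanach.{u₁}) (F : ScBanach.{u₂}) : ScOp (E.prod F) F where
  map i := ContinuousLinearMap.snd ℝ (E.lev i) (F.lev i)
  comm _ _ := rfl

/-- The identification `TE ⊕ TF = T(E ⊕ F)`. -/
noncomputable def tangentProd (E : ScBanach.{u₁}) (F : ScBanach.{u₂}) :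
    ScOp (E.tangent.prod F.tangent) (E.prod F).tangent where
  map i := (ContinuousLinearEquiv.prodProdProdComm ℝ (E.lev (i + 1)) (E.lev i)
    (F.lev (i + 1)) (F.lev i)).toContinuousLinearMap
  comm _ _ := rfl

end ScOp

/-! ## Sc-smooth maps -/

section ScSmoothMaps

variable {E : ScBanach.{u₁}} {F : ScBanach.{u₂}} {G : ScBanach.{u₃}}

theorem ScCont.prodMk {f : E.lev 0 → F.lev 0} {g : E.lev 0 → G.lev 0} {U : Set (E.lev 0)}
    (hf : ScCont f U) (hg : ScCont g U) :
    ScCont (F := F.prod G) (fun x => ((f x, g x) : F.lev 0 × G.lev 0)) U := fun i => by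
  obtain ⟨f', hf', hff⟩ := hf i
  obtain ⟨g', hg', hgg⟩ := hg i
  refine ⟨fun x => ((f' x, g' x) : F.lev i × G.lev i), hf'.prodMk hg', fun x hx => ?_⟩
  rw [ScBanach.prod_toZero]
  exact Prod.ext (hff x hx) (hgg x hx)

/-- The tangent map of a pair is the pair of tangent maps up to reordering factors, and the
reordering `ScOp.tangentProd` is an sc-operator. -/
theorem ScDiff.prodMk {k : ℕ} {f : E.lev 0 → F.lev 0} {g : E.lev 0 → G.lev 0}
    {U : Set (E.lev 0)} (hf : ScDiff k f U) (hg : ScDiff k g U) :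
    ScDiff k (F := F.prod G) (fun x => ((f x, g x) : F.lev 0 × G.lev 0)) U := by
  induction k generalizing E F G with
  | zero => exact ScCont.prodMk hf hg
  | succ k ih =>
    obtain ⟨hfc, f₁, Df, hDf, hTf⟩ := hf
    obtain ⟨hgc, g₁, Dg, hDg, hTg⟩ := hg
    refine ⟨hfc.prodMk hgc, fun x => ((f₁ x, g₁ x) : F.lev 1 × G.lev 1),
      fun x => (Df x).prod (Dg x), fun x hx => ⟨?_, ?_⟩, ?_⟩
    · exact Prod.ext (hDf x hx).1 (hDg x hx).1
    · exact HasFDerivWithinAt.prodMk (hDf x hx).2 (hDg x hx).2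
    · exact ((ScOp.tangentProd F G).scDiff univ k).comp (ih hTf hTg) IsScDomain.univ
        (mapsTo_univ _ _)

variable {f : E.lev 0 → F.lev 0} {U U' : Set (E.lev 0)}

theorem ScSmooth.continuousOn (h : ScSmooth f U) : ContinuousOn f U := (h 0).scCont.continuousOn

theorem ScSmooth.congr {g : E.lev 0 → F.lev 0} (h : ScSmooth f U) (hfg : EqOn g f U) :
    ScSmooth g U := fun k => (h k).congr hfg

theorem ScSmooth.mono (h : ScSmooth f U) (hU : U' ⊆ U) : ScSmooth f U' := fun k => (h k).mono hU

theorem ScSmooth.comp {g : F.lev 0 → G.lev 0} {V : Set (F.lev 0)} (hg : ScSmooth g V)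
    (hf : ScSmooth f U) (hV : IsScDomain V) (hm : MapsTo f U V) : ScSmooth (g ∘ f) U :=
  fun k => (hg k).comp (hf k) hV hm

theorem ScSmooth.of_local (hU : IsScDomain U)
    (h : ∀ x ∈ U, ∃ G : Set (E.lev 0), IsOpen G ∧ x ∈ G ∧ ScSmooth f (U ∩ G)) :
    ScSmooth f U := fun k => ScDiff.of_local hU fun x hx => by
  obtain ⟨G, hG, hxG, hs⟩ := h x hx
  exact ⟨G, hG, hxG, hs k⟩

theorem ScSmooth.prodMk {g : E.lev 0 → G.lev 0} (hf : ScSmooth f U) (hg : ScSmooth g U) :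
    ScSmooth (F := F.prod G) (fun x => ((f x, g x) : F.lev 0 × G.lev 0)) U :=
  fun k => (hf k).prodMk (hg k)

theorem ScSmooth.fst {f : E.lev 0 → F.lev 0 × G.lev 0} (hf : ScSmooth (F := F.prod G) f U) :
    ScSmooth (fun x => (f x).1) U :=
  ((ScOp.fst F G).scSmooth univ).comp hf IsScDomain.univ (mapsTo_univ _ _)

theorem ScSmooth.snd {f : E.lev 0 → F.lev 0 × G.lev 0} (hf : ScSmooth (F := F.prod G) f U) :
    ScSmooth (fun x => (f x).2) U :=
  ((ScOp.snd F G).scSmooth univ).comp hf IsScDomain.univ (mapsTo_univ _ _)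

theorem ScSmooth.exists_lift (h : ScSmooth f U) {x : E.lev 1} (hx : E.incl 0 x ∈ U) :
    ∃ y : F.lev 1, F.incl 0 y = f (E.incl 0 x) := by
  obtain ⟨-, f₁, D, hD, -⟩ := h 1
  exact ⟨f₁ x, (hD x hx).1⟩

theorem ScSmooth.exists_hasScDerivAt (h : ScSmooth f U) {x : E.lev 1} (hx : E.incl 0 x ∈ U) :
    ∃ D, HasScDerivAt f U x D := by
  obtain ⟨-, f₁, D, hD, -⟩ := h 1
  exact ⟨D x, (hD x hx).2⟩

/-- A pointwise form for given derivatives: uniqueness on the sc-domain V identifies D' with the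
member of the continuous family that smoothness of g provides. -/
theorem HasScDerivAt.comp_of_scSmooth {g : F.lev 0 → G.lev 0} {V : Set (F.lev 0)}
    {x : E.lev 1} {y : F.lev 1} {D : E.lev 0 →L[ℝ] F.lev 0} {D' : F.lev 0 →L[ℝ] G.lev 0}
    (hD' : HasScDerivAt g V y D') (hD : HasScDerivAt f U x D) (hg : ScSmooth g V)
    (hf : ScSmooth f U) (hV : IsScDomain V) (hm : MapsTo f U V)
    (hx : E.incl 0 x ∈ U) (hy : F.incl 0 y = f (E.incl 0 x)) :
    HasScDerivAt (g ∘ f) U x (D'.comp D) := by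
  obtain ⟨-, f₁, Df, hDf, hTf⟩ := hf 1
  obtain ⟨-, g₁, Dg, hDg, hTg⟩ := hg 1
  have hcf : ContinuousOn (fun z : E.lev 1 × E.lev 0 => (f₁ z.1, Df z.1 z.2))
      {z : E.lev 1 × E.lev 0 | E.incl 0 z.1 ∈ U} := hTf.scCont.continuousOn
  have hcg : ContinuousOn (fun z : F.lev 1 × F.lev 0 => (g₁ z.1, Dg z.1 z.2))
      {z : F.lev 1 × F.lev 0 | F.incl 0 z.1 ∈ V} := hTg.scCont.continuousOn
  have hcf₁ : ContinuousOn f₁ (E.incl 0 ⁻¹' U) :=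
    (continuous_fst.comp_continuousOn hcf).comp
      (f := fun x => ((x, 0) : E.lev 1 × E.lev 0)) (by fun_prop) fun x hx => hx
  have hyV : F.incl 0 y ∈ V := hy ▸ hm hx
  have hfy : f₁ x = y := F.incl_injective 0 (((hDf x hx).1).trans hy.symm)
  have e : D' = Dg (f₁ x) := hfy ▸ HasScDerivAt.unique hV hyV hD' (hDg y hyV).2
  rw [e]
  exact hD.comp hx (hcf₁ x hx) (fun y hy => (hDf y hy).1) hV hm
    (fun y hy => (hDg y hy).2)
    ((continuous_snd.comp_continuousOn hcg).mono fun z hz => hz.1)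

/-- At a smooth point the sc-derivative is an sc-operator. -/
theorem HasScDerivAt.exists_scOp (h : ScSmooth f U) (hU : IsScDomain U) {x : E.lev 1}
    (hx : E.incl 0 x ∈ U) (hs : E.IsSmoothPt x) {D : E.lev 0 →L[ℝ] F.lev 0}
    (hD : HasScDerivAt f U x D) : ∃ L : ScOp E F, L.map 0 = D := by
  obtain ⟨-, f₁, Df, hDf, hTf⟩ := h 1
  obtain ⟨s, hs, rfl⟩ := hs
  have e : D = Df (s 1) := hD.unique hU hx (hDf _ hx).2
  have hs0 : ∀ i, E.toOne i (s (i + 1)) = s 1 := fun i => by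
    induction i with
    | zero => rfl
    | succ i ih => change E.toOne i (E.incl (i + 1) (s (i + 2))) = _; rw [hs, ih]
  have key : ∀ i, ∃ L : E.lev i →L[ℝ] F.lev i, ∀ v, F.toZero i (L v) = D (E.toZero i v) := by
    intro i
    -- Level i of the tangent space is E_{i+1} ⊕ E_i. Since x lies in every E_{i+1}, freezing the
    -- base point there leaves a continuous map E_i → F_i.
    obtain ⟨g, hg, hgT⟩ := hTf.scCont i
    have hmem : ∀ v : E.lev i, ((s (i + 1), v) : E.lev (i + 1) × E.lev i) ∈
        E.tangent.levelSet {z : E.lev 1 × E.lev 0 | E.incl 0 z.1 ∈ U} i := fun v => by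
      change E.tangent.toZero i (s (i + 1), v) ∈ {z : E.lev 1 × E.lev 0 | E.incl 0 z.1 ∈ U}
      rw [E.tangent_toZero]
      change E.incl 0 (E.toOne i (s (i + 1))) ∈ U
      rwa [hs0]
    let g2 : E.lev i → F.lev i := fun v => (g (s (i + 1), v)).2
    have hg2 : ∀ v, F.toZero i (g2 v) = D (E.toZero i v) := fun v => by
      have h1 := (F.tangent_toZero i _).symm.trans ((hgT _ (hmem v)).trans (congrArg
        (fun z : E.lev 1 × E.lev 0 => ((f₁ z.1, Df z.1 z.2) : F.lev 1 × F.lev 0))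
        (E.tangent_toZero i (s (i + 1), v))))
      have h2 := congrArg Prod.snd h1
      change F.toZero i (g2 v) = Df (E.toOne i (s (i + 1))) (E.toZero i v) at h2
      rw [h2, hs0, e]
    have hc : Continuous g2 := by
      refine continuous_snd.comp (Y := F.lev (i + 1) × F.lev i)
        (g := Prod.snd) (f := fun v => g (s (i + 1), v)) ?_
      exact hg.comp_continuous (f := fun v => ((s (i + 1), v) : E.lev (i + 1) × E.lev i))
        (by fun_prop) hmem
    exact ⟨{ toFun := g2
             map_add' := fun a b => F.toZero_injective i (by simp only [map_add, hg2])
             map_smul' := fun r a => F.toZero_injective i (by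
              simp only [map_smul, hg2, RingHom.id_apply])
             cont := hc }, hg2⟩
  choose L hL using key
  refine ⟨⟨L, fun i v => F.toZero_injective i ?_⟩, ?_⟩
  · rw [hL]; exact hL (i + 1) v
  · ext v; exact hL 0 v

end ScSmoothMaps

/-! ## Partial quadrants as domains -/

namespace PartialQuadrant

variable {E : ScBanach.{u₁}} {F : ScBanach.{u₂}}

/-- The coordinates as a bounded operator. -/
noncomputable def coordL (C : PartialQuadrant E) : E.lev 0 →L[ℝ] (C.idx → ℝ) :=
  (ContinuousLinearMap.fst ℝ (C.idx → ℝ) (C.W.lev 0)).comp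
    (C.T.equiv 0).symm.toContinuousLinearMap

theorem coordL_apply (C : PartialQuadrant E) (x : E.lev 0) : C.coordL x = C.coord x := rfl

theorem coord_T (C : PartialQuadrant E) (z : (C.idx → ℝ) × C.W.lev 0) :
    C.coord (C.T.equiv 0 z) = z.1 :=
  congrArg Prod.fst ((C.T.equiv 0).symm_apply_apply z)

theorem convex_carrier (C : PartialQuadrant E) : Convex ℝ C.carrier := by
  intro x hx y hy a b ha hb _ i
  change 0 ≤ C.coordL (a • x + b • y) i
  rw [map_add, map_smul, map_smul]
  exact add_nonneg (mul_nonneg ha (hx i)) (mul_nonneg hb (hy i))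

theorem nonempty_interior_carrier (C : PartialQuadrant E) : (interior C.carrier).Nonempty := by
  have ho : IsOpen (C.coordL ⁻¹' {a | ∀ i, 0 < a i}) := by
    refine IsOpen.preimage C.coordL.continuous ?_
    simp only [ofPred_forall]
    exact isOpen_iInter_of_finite fun i => isOpen_lt continuous_const (continuous_apply i)
  refine ⟨C.T.equiv 0 ((fun _ => (1 : ℝ), 0) : (C.idx → ℝ) × C.W.lev 0),
    interior_maximal (fun x hx i => (hx i).le) ho fun i => ?_⟩
  rw [coordL_apply, coord_T]
  exact one_pos

theorem IsRelOpen.isScDomain {C : PartialQuadrant E} {U : Set (E.lev 0)} (h : C.IsRelOpen U) :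
    IsScDomain U := by
  obtain ⟨G, hG, rfl⟩ := h
  exact ⟨G, C.carrier, hG, C.convex_carrier, C.nonempty_interior_carrier, rfl⟩

theorem IsRelOpen.inter_open {C : PartialQuadrant E} {U G : Set (E.lev 0)} (h : C.IsRelOpen U)
    (hG : IsOpen G) : C.IsRelOpen (U ∩ G) := by
  obtain ⟨G', hG', rfl⟩ := h
  exact ⟨G' ∩ G, hG'.inter hG, by ac_rfl⟩

theorem IsRelOpen.subset_carrier {C : PartialQuadrant E} {U : Set (E.lev 0)}
    (h : C.IsRelOpen U) : U ⊆ C.carrier := by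
  obtain ⟨G, -, rfl⟩ := h
  exact inter_subset_right

theorem mem_carrier_prod {C : PartialQuadrant E} {D : PartialQuadrant F}
    (x : E.lev 0 × F.lev 0) : x ∈ (C.prod D).carrier ↔ x.1 ∈ C.carrier ∧ x.2 ∈ D.carrier :=
  ⟨fun h => ⟨fun i => h (Sum.inl i), fun i => h (Sum.inr i)⟩,
    fun h i => i.casesOn (fun j => h.1 j) fun j => h.2 j⟩

theorem IsRelOpen.prod {C : PartialQuadrant E} {D : PartialQuadrant F} {U : Set (E.lev 0)}
    {V : Set (F.lev 0)} (hU : C.IsRelOpen U) (hV : D.IsRelOpen V) :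
    (C.prod D).IsRelOpen (U ×ˢ V) := by
  obtain ⟨G, hG, rfl⟩ := hU
  obtain ⟨N, hN, rfl⟩ := hV
  refine ⟨G ×ˢ N, hG.prod hN, ?_⟩
  exact Set.ext fun x => ⟨fun h => ⟨⟨h.1.1, h.2.1⟩, (mem_carrier_prod x).2 ⟨h.1.2, h.2.2⟩⟩,
    fun h => ⟨⟨h.1.1, ((mem_carrier_prod x).1 h.2).1⟩, h.1.2, ((mem_carrier_prod x).1 h.2).2⟩⟩

end PartialQuadrant

/-! ## Retractions -/

section Retractions

theorem exists_isOpen_inter_preimage {A B : Type*} [TopologicalSpace A] [TopologicalSpace B]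
    {f : A → B} {U : Set A} (hf : ContinuousOn f U) {O : Set B} (hO : IsOpen O) :
    ∃ G, IsOpen G ∧ U ∩ f ⁻¹' O = U ∩ G := by
  obtain ⟨G, hG, h⟩ := continuousOn_iff'.1 hf O hO
  exact ⟨G, hG, by rw [inter_comm, h, inter_comm]⟩

variable {E : ScBanach.{u₁}} {F : ScBanach.{u₂}} {C : PartialQuadrant E} {D : PartialQuadrant F}
  {U : Set (E.lev 0)} {r : E.lev 0 → E.lev 0}

namespace IsScRetraction

theorem isScDomain (h : IsScRetraction C U r) : IsScDomain U := h.relOpen.isScDomain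

theorem eq_of_mem_image (h : IsScRetraction C U r) {x : E.lev 0} (hx : x ∈ r '' U) : r x = x := by
  obtain ⟨y, hy, rfl⟩ := hx
  exact h.idem y hy

theorem image_subset (h : IsScRetraction C U r) : r '' U ⊆ U := h.mapsTo.image_subset

theorem restrict (h : IsScRetraction C U r) {S G : Set (E.lev 0)} (hG : IsOpen G)
    (hS : U ∩ r ⁻¹' S = U ∩ G) :
    IsScRetraction C (U ∩ r ⁻¹' S) r ∧ r '' (U ∩ r ⁻¹' S) = r '' U ∩ S := by
  refine ⟨⟨hS ▸ h.relOpen.inter_open hG, fun x hx => ⟨h.mapsTo hx.1, ?_⟩,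
    h.smooth.mono inter_subset_left, fun x hx => h.idem x hx.1⟩, image_inter_preimage r U S⟩
  change r (r x) ∈ S
  rw [h.idem x hx.1]; exact hx.2

theorem prod (h : IsScRetraction C U r) {V : Set (F.lev 0)} {s : F.lev 0 → F.lev 0}
    (h' : IsScRetraction D V s) :
    IsScRetraction (E := E.prod F) (C.prod D) (U ×ˢ V) (Prod.map r s) where
  relOpen := h.relOpen.prod h'.relOpen
  mapsTo := h.mapsTo.prodMap h'.mapsTo
  smooth := ScSmooth.prodMk (E := E.prod F)
    (h.smooth.comp ((ScOp.fst E F).scSmooth (U ×ˢ V)) h.isScDomain fun _ hx => hx.1)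
    (h'.smooth.comp ((ScOp.snd E F).scSmooth (U ×ˢ V)) h'.isScDomain fun _ hx => hx.2)
  idem x hx := Prod.ext (h.idem x.1 hx.1) (h'.idem x.2 hx.2)

end IsScRetraction

/-- A retraction onto O is the identity on O, so f ∘ g = (f ∘ r) ∘ g and the chosen r disappears. -/
theorem ScSmoothOnRetract.comp {G : ScBanach.{u₃}} {f : E.lev 0 → F.lev 0} {O : Set (E.lev 0)}
    (hf : ScSmoothOnRetract C f O) {g : G.lev 0 → E.lev 0} {V : Set (G.lev 0)}
    (hg : ScSmooth g V) (hm : MapsTo g V O) : ScSmooth (f ∘ g) V := by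
  obtain ⟨U, r, hr, rfl, hs⟩ := hf
  refine (hs.comp hg hr.isScDomain fun x hx => hr.image_subset (hm hx)).congr fun x hx => ?_
  simp only [Function.comp_apply, hr.eq_of_mem_image (hm hx)]

end Retractions

/-! ## Plots -/

section Plots

variable {X : Type u₁} [TopologicalSpace X] {Z : Type u₃} [TopologicalSpace Z]
  {A : Set (ModelChart.{u₁, u₂} X)} {B : Set (ModelChart.{u₃, u₄} Z)}
  {E : ScBanach.{u₅}} {F : ScBanach.{u₆}} {U : Set (E.lev 0)} {α : E.lev 0 → X}

/-- A plot is a continuous map from a subset of an sc-Banach space that is sc-smooth in the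
given charts. -/
def IsPlot (A : Set (ModelChart.{u₁, u₂} X)) {E : ScBanach.{u₅}} (U : Set (E.lev 0))
    (α : E.lev 0 → X) : Prop :=
  ContinuousOn α U ∧ ∀ c ∈ A, ScSmooth (F := c.E) (c.e ∘ α) (U ∩ α ⁻¹' c.e.source)

/-- A set of charts onto sc-smooth retracts, covering the space, with sc-smooth transitions. -/
structure IsScAtlas (A : Set (ModelChart.{u₁, u₂} X)) : Prop where
  retract : ∀ c ∈ A, IsScRetract c.C c.e.target
  cover : ∀ x, ∃ c ∈ A, x ∈ c.e.source
  compat : ∀ c ∈ A, ∀ c' ∈ A, c.SmoothTransition c'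

theorem MPolyfold.isScAtlas (S : MPolyfold.{u₁, u₂} X) : IsScAtlas S.charts :=
  ⟨S.retract, S.cover, S.compat⟩

namespace IsPlot

theorem mono (h : IsPlot A U α) {U' : Set (E.lev 0)} (hU : U' ⊆ U) : IsPlot A U' α :=
  ⟨h.1.mono hU, fun c hc => (h.2 c hc).mono (inter_subset_inter_left _ hU)⟩

theorem congr (h : IsPlot A U α) {β : E.lev 0 → X} (hβ : EqOn β α U) : IsPlot A U β := by
  refine ⟨h.1.congr hβ, fun c hc => ?_⟩
  have e : U ∩ β ⁻¹' c.e.source = U ∩ α ⁻¹' c.e.source := by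
    ext x
    simp only [mem_inter_iff, mem_preimage]
    exact and_congr_right fun hx => by rw [hβ hx]
  rw [e]
  exact (h.2 c hc).congr fun x hx => congrArg c.e (hβ hx.1)

theorem isScDomain_inter (h : IsPlot A U α) (hU : IsScDomain U) {O : Set X} (hO : IsOpen O) :
    IsScDomain (U ∩ α ⁻¹' O) := by
  obtain ⟨G, hG, e⟩ := exists_isOpen_inter_preimage h.1 hO
  exact e ▸ hU.inter_open hG

theorem scSmooth (h : IsPlot A U α) {c : ModelChart.{u₁, u₂} X} (hc : c ∈ A)
    (hm : MapsTo α U c.e.source) : ScSmooth (F := c.E) (c.e ∘ α) U :=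
  (h.2 c hc).mono fun _ hx => ⟨hx, hm hx⟩

theorem comp (h : IsPlot A U α) (hU : IsScDomain U) {V : Set (F.lev 0)} {g : F.lev 0 → E.lev 0}
    (hg : ScSmooth g V) (hm : MapsTo g V U) : IsPlot A V (α ∘ g) :=
  ⟨h.1.comp hg.continuousOn hm, fun c hc =>
    ((h.2 c hc).comp (hg.mono inter_subset_left) (h.isScDomain_inter hU c.open_source)
      fun _ hx => ⟨hm hx.1, hx.2⟩)⟩

theorem of_local (hU : IsScDomain U)
    (h : ∀ x ∈ U, ∃ G : Set (E.lev 0), IsOpen G ∧ x ∈ G ∧ IsPlot A (U ∩ G) α) :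
    IsPlot A U α := by
  have hc : ContinuousOn α U := fun x hx => by
    obtain ⟨G, hG, hxG, hp⟩ := h x hx
    exact (continuousWithinAt_inter (hG.mem_nhds hxG)).1 (hp.1 x ⟨hx, hxG⟩)
  refine ⟨hc, fun c hcA => ?_⟩
  obtain ⟨N, hN, e⟩ := exists_isOpen_inter_preimage hc c.open_source
  refine ScSmooth.of_local (e ▸ hU.inter_open hN) fun x hx => ?_
  obtain ⟨G, hG, hxG, hp⟩ := h x hx.1
  exact ⟨G, hG, hxG, (hp.2 c hcA).mono fun y hy => ⟨⟨hy.1.1, hy.2⟩, hy.1.2⟩⟩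

theorem map (h : IsPlot A U α) (hU : IsScDomain U) (hA : ∀ x, ∃ c ∈ A, x ∈ c.e.source)
    {f : X → Z} {W : Set X} (hf : ScSmoothMapOn A B f W) (hm : MapsTo α U W) :
    IsPlot B U (f ∘ α) := by
  have hc : ContinuousOn (f ∘ α) U := hf.1.comp h.1 hm
  refine ⟨hc, fun d hd => ?_⟩
  obtain ⟨N, hN, e⟩ := exists_isOpen_inter_preimage hc d.open_source
  rw [e]
  refine ScSmooth.of_local (hU.inter_open hN) fun x hx => ?_
  obtain ⟨c, hcA, hxc⟩ := hA (α x)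
  obtain ⟨G, hG, e'⟩ := exists_isOpen_inter_preimage h.1 c.open_source
  have hxG : x ∈ U ∩ G := e' ▸ ⟨hx.1, hxc⟩
  refine ⟨G, hG, hxG.2, ?_⟩
  have hsub : ∀ y ∈ U ∩ N ∩ G, α y ∈ c.e.source ∩ W ∩ f ⁻¹' d.e.source := fun y hy => by
    have h1 : y ∈ U ∩ α ⁻¹' c.e.source := e' ▸ ⟨hy.1.1, hy.2⟩
    have h2 : y ∈ U ∩ (f ∘ α) ⁻¹' d.e.source := e ▸ hy.1
    exact ⟨⟨h1.2, hm h1.1⟩, h2.2⟩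
  refine ((hf.2 c hcA d hd).comp
    ((h.mono fun y hy => hy.1.1).scSmooth hcA fun y hy => (hsub y hy).1.1)
    fun y hy => mem_image_of_mem _ (hsub y hy)).congr fun y hy => ?_
  simp only [Function.comp_apply, c.e.left_inv (hsub y hy).1.1]

end IsPlot

theorem scSmoothMapOn_id {A' : Set (ModelChart.{u₁, u₂} X)}
    (h : ∀ c ∈ A, ∀ d ∈ A', c.SmoothTransition d) : ScSmoothMapOn A A' id univ := by
  refine ⟨continuousOn_id, fun c hc d hd => ?_⟩
  simpa [ModelChart.SmoothTransition] using h c hc d hd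

theorem IsPlot.change {A' : Set (ModelChart.{u₁, u₂} X)} (h : IsPlot A U α) (hU : IsScDomain U)
    (hA : ∀ x, ∃ c ∈ A, x ∈ c.e.source) (hAA' : ∀ c ∈ A, ∀ d ∈ A', c.SmoothTransition d) :
    IsPlot A' U α :=
  h.map hU hA (scSmoothMapOn_id hAA') (mapsTo_univ _ _)

/-! ## The plots defined by charts -/

namespace ModelChart

variable {c : ModelChart.{u₁, u₂} X} {V : Set (c.E.lev 0)} {r : c.E.lev 0 → c.E.lev 0}

/-- The map parametrizing the domain of a chart, given a retraction onto its image. -/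
def param (c : ModelChart.{u₁, u₂} X) (r : c.E.lev 0 → c.E.lev 0) : c.E.lev 0 → X :=
  c.e.symm ∘ r

theorem mapsTo_target (ht : r '' V = c.e.target) : MapsTo r V c.e.target :=
  fun _ hx => ht ▸ mem_image_of_mem r hx

theorem mapsTo_param (ht : r '' V = c.e.target) : MapsTo (c.param r) V c.e.source :=
  fun _ hx => c.e.map_target (mapsTo_target ht hx)

theorem e_param (ht : r '' V = c.e.target) {x : c.E.lev 0} (hx : x ∈ V) :
    c.e (c.param r x) = r x :=
  c.e.right_inv (mapsTo_target ht hx)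

theorem mem_of_target (hr : IsScRetraction c.C V r) (ht : r '' V = c.e.target) {x : X}
    (hx : x ∈ c.e.source) : c.e x ∈ V :=
  hr.image_subset (ht ▸ c.e.map_source hx)

theorem param_e (hr : IsScRetraction c.C V r) (ht : r '' V = c.e.target) {x : X}
    (hx : x ∈ c.e.source) : c.param r (c.e x) = x := by
  rw [param, Function.comp_apply, hr.eq_of_mem_image (ht ▸ c.e.map_source hx), c.e.left_inv hx]

theorem continuousOn_param (hr : IsScRetraction c.C V r) (ht : r '' V = c.e.target) :
    ContinuousOn (c.param r) V :=
  c.continuousOn_invFun.comp hr.smooth.continuousOn (mapsTo_target ht)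

theorem preimage_param (ht : r '' V = c.e.target) {O : Set X} (hO : O ⊆ c.e.source) :
    V ∩ c.param r ⁻¹' O = V ∩ r ⁻¹' (c.e '' O) := by
  ext x
  refine and_congr_right fun hx => ⟨fun h => ⟨c.param r x, h, e_param ht hx⟩, ?_⟩
  rintro ⟨y, hy, hyx⟩
  change c.e.symm (r x) ∈ O
  rwa [← hyx, c.e.left_inv (hO hy)]

/-- Supplies the retraction that `ScSmoothOnRetract` demands over any open part of a chart domain.
-/
theorem restrict_param (hr : IsScRetraction c.C V r) (ht : r '' V = c.e.target) {O : Set X}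
    (hO : IsOpen O) (hOs : O ⊆ c.e.source) :
    IsScRetraction c.C (V ∩ c.param r ⁻¹' O) r ∧ r '' (V ∩ c.param r ⁻¹' O) = c.e '' O := by
  obtain ⟨G, hG, e⟩ := exists_isOpen_inter_preimage (continuousOn_param hr ht) hO
  rw [preimage_param ht hOs] at e ⊢
  obtain ⟨h1, h2⟩ := hr.restrict hG e
  refine ⟨h1, h2.trans ?_⟩
  rw [ht, inter_eq_right]
  rintro _ ⟨y, hy, rfl⟩
  exact c.e.map_source (hOs hy)

theorem isPlot_param (hr : IsScRetraction c.C V r) (ht : r '' V = c.e.target)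
    {B : Set (ModelChart.{u₁, u₂} X)} (hB : ∀ d ∈ B, c.SmoothTransition d) :
    IsPlot B V (c.param r) := by
  refine ⟨continuousOn_param hr ht, fun d hd => ?_⟩
  exact (hB d hd).comp (hr.smooth.mono inter_subset_left) fun x hx =>
    ⟨c.param r x, ⟨mapsTo_param ht hx.1, hx.2⟩, e_param ht hx.1⟩

/-- Together with `isPlot_param`, this turns compatibility of charts into a statement about one
plot, the parametrization of the chart. -/
theorem smoothTransition_of_isPlot (hr : IsScRetraction c.C V r) (ht : r '' V = c.e.target)
    {B : Set (ModelChart.{u₁, u₂} X)} (hB : IsPlot B V (c.param r))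
    {d : ModelChart.{u₁, u₂} X} (hd : d ∈ B) : c.SmoothTransition d := by
  obtain ⟨h1, h2⟩ := restrict_param hr ht (c.open_source.inter d.open_source) inter_subset_left
  exact ⟨_, r, h1, h2, (hB.2 d hd).mono fun x hx => ⟨hx.1, hx.2.2⟩⟩

end ModelChart

theorem IsScAtlas.isPlot_param (hA : IsScAtlas A) {c : ModelChart.{u₁, u₂} X} (hc : c ∈ A)
    {V : Set (c.E.lev 0)} {r : c.E.lev 0 → c.E.lev 0}
    (hr : IsScRetraction c.C V r) (ht : r '' V = c.e.target) : IsPlot A V (c.param r) :=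
  ModelChart.isPlot_param hr ht (hA.compat c hc)

/-- A map sending plots to plots is sc-smooth. -/
theorem IsScAtlas.scSmoothMapOn (hA : IsScAtlas A) {f : X → Z} {W : Set X} (hW : IsOpen W)
    (h : ∀ (E : ScBanach.{u₂}) (U : Set (E.lev 0)) (α : E.lev 0 → X), IsScDomain U →
      IsPlot A U α → MapsTo α U W → IsPlot B U (f ∘ α)) : ScSmoothMapOn A B f W := by
  have key : ∀ c ∈ A, ∀ (V : Set (c.E.lev 0)) (r : c.E.lev 0 → c.E.lev 0),
      IsScRetraction c.C V r → r '' V = c.e.target →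
      IsPlot B (V ∩ c.param r ⁻¹' W) (f ∘ c.param r) := fun c hc V r hr ht => by
    have hp := hA.isPlot_param hc hr ht
    exact h c.E _ _ (hp.isScDomain_inter hr.isScDomain hW) (hp.mono inter_subset_left)
      fun x hx => hx.2
  have hcont : ContinuousOn f W := by
    intro x hx
    obtain ⟨c, hc, hxc⟩ := hA.cover x
    obtain ⟨V, r, hr, ht⟩ := hA.retract c hc
    have h1 : ContinuousOn (f ∘ c.param r ∘ c.e) (W ∩ c.e.source) :=
      (key c hc V r hr ht).1.comp (c.continuousOn_toFun.mono inter_subset_right) fun y hy =>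
        ⟨ModelChart.mem_of_target hr ht hy.2, by
          change c.param r (c.e y) ∈ W
          rw [ModelChart.param_e hr ht hy.2]; exact hy.1⟩
    refine (continuousWithinAt_inter (c.open_source.mem_nhds hxc)).1 ?_
    exact h1.congr (fun y hy => by
      simp only [Function.comp_apply, ModelChart.param_e hr ht hy.2]) x ⟨hx, hxc⟩
  refine ⟨hcont, fun c hc d hd => ?_⟩
  obtain ⟨V, r, hr, ht⟩ := hA.retract c hc
  have ho : IsOpen (c.e.source ∩ W ∩ f ⁻¹' d.e.source) := by
    rw [inter_assoc]
    exact c.open_source.inter (hcont.isOpen_inter_preimage hW d.open_source)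
  obtain ⟨h1, h2⟩ := ModelChart.restrict_param hr ht ho fun x hx => hx.1.1
  exact ⟨_, r, h1, h2, ((key c hc V r hr ht).2 d hd).mono
    fun x hx => ⟨⟨hx.1, hx.2.1.2⟩, hx.2.2⟩⟩

/-! ## Products -/

theorem ModelChart.SmoothTransition.prod {c c' : ModelChart.{u₁, u₂} X}
    {d d' : ModelChart.{u₃, u₄} Z} (hc : c.SmoothTransition c') (hd : d.SmoothTransition d') :
    (c.prod d).SmoothTransition (c'.prod d') := by
  obtain ⟨U, r, hr, hrU, hs⟩ := hc
  obtain ⟨V, s, hs', hsV, ht⟩ := hd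
  refine ⟨U ×ˢ V, Prod.map r s, hr.prod hs', ?_, ?_⟩
  · refine (prodMap_image_prod r s U V).trans ?_
    rw [hrU, hsV, ← prodMap_image_prod, prod_inter_prod.symm]
    rfl
  · exact ScSmooth.prodMk (E := c.E.prod d.E)
      (hs.comp ((ScOp.fst c.E d.E).scSmooth (U ×ˢ V)) hr.isScDomain fun x hx => hx.1)
      (ht.comp ((ScOp.snd c.E d.E).scSmooth (U ×ˢ V)) hs'.isScDomain fun x hx => hx.2)

theorem IsScAtlas.prod (hA : IsScAtlas A) (hB : IsScAtlas B) : IsScAtlas (prodCharts A B) where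
  retract := by
    rintro _ ⟨c, hc, d, hd, rfl⟩
    obtain ⟨U, r, hr, hrU⟩ := hA.retract c hc
    obtain ⟨V, s, hs, hsV⟩ := hB.retract d hd
    exact ⟨U ×ˢ V, Prod.map r s, hr.prod hs, by
      refine (prodMap_image_prod r s U V).trans ?_
      rw [hrU, hsV]; rfl⟩
  cover x := by
    obtain ⟨c, hc, hx⟩ := hA.cover x.1
    obtain ⟨d, hd, hx'⟩ := hB.cover x.2
    exact ⟨c.prod d, ⟨c, hc, d, hd, rfl⟩, hx, hx'⟩
  compat := by
    rintro _ ⟨c, hc, d, hd, rfl⟩ _ ⟨c', hc', d', hd', rfl⟩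
    exact (hA.compat c hc c' hc').prod (hB.compat d hd d' hd')

theorem IsPlot.prodMk (h : IsPlot A U α) {β : E.lev 0 → Z} (h' : IsPlot B U β) :
    IsPlot (prodCharts A B) U fun x => (α x, β x) := by
  refine ⟨h.1.prodMk h'.1, ?_⟩
  rintro _ ⟨c, hc, d, hd, rfl⟩
  exact ScSmooth.prodMk ((h.2 c hc).mono fun x hx => ⟨hx.1, hx.2.1⟩)
    ((h'.2 d hd).mono fun x hx => ⟨hx.1, hx.2.2⟩)

/-- Smoothness into a product is only tested in product charts; locally an auxiliary chart of the
other factor is inserted and then projected away. -/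
theorem IsPlot.fst {γ : E.lev 0 → X × Z} (h : IsPlot (prodCharts A B) U γ) (hU : IsScDomain U)
    (hB : ∀ x, ∃ d ∈ B, x ∈ d.e.source) : IsPlot A U fun x => (γ x).1 := by
  have hc : ContinuousOn (fun x => (γ x).1) U := continuous_fst.comp_continuousOn h.1
  refine ⟨hc, fun c hcA => ?_⟩
  obtain ⟨N, hN, e⟩ := exists_isOpen_inter_preimage hc c.open_source
  rw [e]
  refine ScSmooth.of_local (hU.inter_open hN) fun x hx => ?_
  obtain ⟨d, hd, hxd⟩ := hB (γ x).2
  obtain ⟨G, hG, e'⟩ := exists_isOpen_inter_preimage (continuous_snd.comp_continuousOn h.1)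
    d.open_source
  have hxG : x ∈ U ∩ G := e' ▸ ⟨hx.1, hxd⟩
  refine ⟨G, hG, hxG.2, ScSmooth.fst (F := c.E) (G := d.E)
    ((h.2 (c.prod d) ⟨c, hcA, d, hd, rfl⟩).mono fun y hy => ⟨hy.1.1, ?_⟩)⟩
  have h1 := e'.ge ⟨hy.1.1, hy.2⟩
  have h2 := e.ge hy.1
  exact ⟨h2.2, h1.2⟩

theorem IsPlot.snd {γ : E.lev 0 → X × Z} (h : IsPlot (prodCharts A B) U γ) (hU : IsScDomain U)
    (hA : ∀ x, ∃ c ∈ A, x ∈ c.e.source) : IsPlot B U fun x => (γ x).2 := by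
  have hc : ContinuousOn (fun x => (γ x).2) U := continuous_snd.comp_continuousOn h.1
  refine ⟨hc, fun d hd => ?_⟩
  obtain ⟨N, hN, e⟩ := exists_isOpen_inter_preimage hc d.open_source
  rw [e]
  refine ScSmooth.of_local (hU.inter_open hN) fun x hx => ?_
  obtain ⟨c, hcA, hxc⟩ := hA (γ x).1
  obtain ⟨G, hG, e'⟩ := exists_isOpen_inter_preimage (continuous_fst.comp_continuousOn h.1)
    c.open_source
  have hxG : x ∈ U ∩ G := e' ▸ ⟨hx.1, hxc⟩
  refine ⟨G, hG, hxG.2, ScSmooth.snd (F := c.E) (G := d.E)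
    ((h.2 (c.prod d) ⟨c, hcA, d, hd, rfl⟩).mono fun y hy => ⟨hy.1.1, ?_⟩)⟩
  have h1 := e'.ge ⟨hy.1.1, hy.2⟩
  have h2 := e.ge hy.1
  exact ⟨h1.2, h2.2⟩

end Plots

/-! ## Faces of partial quadrants -/

namespace PartialQuadrant

variable {E : ScBanach.{u₁}} {F : ScBanach.{u₂}}

/-- The coordinates that vanish at `x`. -/
noncomputable def faceMap (C : PartialQuadrant E) (x : E.lev 0) :
    E.lev 0 →ₗ[ℝ] ({i // C.coord x i = 0} → ℝ) :=
  LinearMap.funLeft ℝ ℝ Subtype.val ∘ₗ C.coordL.toLinearMap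

theorem faceMap_eq_zero_iff (C : PartialQuadrant E) (x v : E.lev 0) :
    C.faceMap x v = 0 ↔ v ∈ C.facePlane x :=
  ⟨fun h i hi => congrFun h ⟨i, hi⟩, fun h => funext fun i => h i.1 i.2⟩

theorem faceMap_surjective (C : PartialQuadrant E) (x : E.lev 0) :
    Function.Surjective (C.faceMap x) := by
  refine (LinearMap.funLeft_surjective_of_injective ℝ ℝ _ Subtype.val_injective).comp fun a => ?_
  exact ⟨C.T.equiv 0 ((a, 0) : (C.idx → ℝ) × C.W.lev 0), C.coord_T _⟩

theorem finrank_face (C : PartialQuadrant E) (x : E.lev 0) :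
    Module.finrank ℝ ({i // C.coord x i = 0} → ℝ) = C.degeneracy x := by
  classical
  rw [Module.finrank_fintype_fun_eq_card, ← Nat.card_eq_fintype_card]
  rfl

/-- The face plane is the kernel of the surjection `faceMap`, so D descends to the
finite-dimensional quotients. -/
theorem exists_faceMap_comp_eq {C : PartialQuadrant E} {C' : PartialQuadrant F} {x : E.lev 0}
    {x' : F.lev 0} {D : E.lev 0 →L[ℝ] F.lev 0}
    (hD : MapsTo D (C.facePlane x) (C'.facePlane x')) :
    ∃ L : ({i // C.coord x i = 0} → ℝ) →ₗ[ℝ] ({i // C'.coord x' i = 0} → ℝ),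
      ∀ v, C'.faceMap x' (D v) = L (C.faceMap x v) := by
  obtain ⟨s, hs⟩ := (C.faceMap x).exists_rightInverse_of_surjective
    (LinearMap.range_eq_top.2 (C.faceMap_surjective x))
  refine ⟨C'.faceMap x' ∘ₗ D.toLinearMap ∘ₗ s, fun v => ?_⟩
  have h1 : v - s (C.faceMap x v) ∈ C.facePlane x := by
    rw [← faceMap_eq_zero_iff, map_sub, sub_eq_zero]
    exact (LinearMap.congr_fun hs _).symm
  have h2 := (C'.faceMap_eq_zero_iff x' _).2 (hD h1)
  rw [map_sub, map_sub, sub_eq_zero] at h2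
  exact h2

/-- On the quotients by the face planes D' ∘ D is onto, hence so is D', and dimensions compare. -/
theorem degeneracy_le_of_factor {C : PartialQuadrant E} {C' : PartialQuadrant F} {x : E.lev 0}
    {x' : F.lev 0} {D : E.lev 0 →L[ℝ] F.lev 0} {D' : F.lev 0 →L[ℝ] E.lev 0}
    (hD : MapsTo D (C.facePlane x) (C'.facePlane x'))
    (hD' : MapsTo D' (C'.facePlane x') (C.facePlane x))
    (hs : ∀ v, ∃ w, ∃ a ∈ C.facePlane x, D' (D w) + a = v) :
    C.degeneracy x ≤ C'.degeneracy x' := by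
  obtain ⟨L, hL⟩ := exists_faceMap_comp_eq hD
  obtain ⟨L', hL'⟩ := exists_faceMap_comp_eq hD'
  rw [← finrank_face, ← finrank_face]
  refine LinearMap.finrank_le_finrank_of_surjective (f := L') fun b => ?_
  obtain ⟨v, rfl⟩ := C.faceMap_surjective x b
  obtain ⟨w, a, ha, rfl⟩ := hs v
  refine ⟨L (C.faceMap x w), ?_⟩
  rw [map_add, (C.faceMap_eq_zero_iff x a).2 ha, add_zero, hL', hL]

/-- If `D` is surjective and respects faces of the same codimension, its kernel lies in the face. -/
theorem mem_facePlane_of_surjective {C : PartialQuadrant E} {C' : PartialQuadrant F}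
    {x : E.lev 0} {x' : F.lev 0} {D : E.lev 0 →L[ℝ] F.lev 0}
    (hD : MapsTo D (C.facePlane x) (C'.facePlane x')) (hs : Function.Surjective D)
    (hd : C.degeneracy x = C'.degeneracy x') {v : E.lev 0} (hv : D v = 0) :
    v ∈ C.facePlane x := by
  obtain ⟨L, hL⟩ := exists_faceMap_comp_eq hD
  have hLs : Function.Surjective L := fun b => by
    obtain ⟨z, rfl⟩ := C'.faceMap_surjective x' b
    obtain ⟨w, rfl⟩ := hs z
    exact ⟨_, (hL w).symm⟩
  have hLi : Function.Injective L :=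
    (LinearMap.injective_iff_surjective_of_finrank_eq_finrank
      ((C.finrank_face x).trans (hd.trans (C'.finrank_face x').symm))).2 hLs
  rw [← faceMap_eq_zero_iff]
  exact hLi (by rw [← hL, hv, map_zero, map_zero])

theorem eventually_degeneracy_le (C : PartialQuadrant E) (x : E.lev 0) :
    ∀ᶠ y in 𝓝 x, C.degeneracy y ≤ C.degeneracy x := by
  have h : ∀ i, ∀ᶠ y in 𝓝 x, C.coord y i = 0 → C.coord x i = 0 := fun i => by
    by_cases hi : C.coord x i = 0
    · exact Eventually.of_forall fun _ _ => hi
    · have hc : Continuous fun y => C.coordL y i := (continuous_apply i).comp C.coordL.continuous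
      filter_upwards [hc.continuousAt.eventually_ne (y := 0) hi] with y hy hy'
      exact absurd hy' hy
  filter_upwards [eventually_all.2 h] with y hy
  exact ncard_le_ncard hy (toFinite _)

/-- The quadrant coordinates are finite-dimensional, hence already smooth; only the W component
needs approximation. -/
theorem exists_smooth_coord_eq (C : PartialQuadrant E) {x : E.lev 0} {N : Set (E.lev 0)}
    (hN : N ∈ 𝓝 x) : ∃ s : ∀ j, E.lev j, (∀ j, E.incl j (s (j + 1)) = s j) ∧ s 0 ∈ N ∧
      C.coord (s 0) = C.coord x := by
  obtain ⟨⟨a, b⟩, rfl⟩ : ∃ z : (C.idx → ℝ) × C.W.lev 0, C.T.equiv 0 z = x :=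
    (C.T.equiv 0).surjective x
  let ι : C.W.lev 0 → E.lev 0 := fun w => C.T.equiv 0 ((a, w) : (C.idx → ℝ) × C.W.lev 0)
  have hι : Continuous ι := (C.T.equiv 0).continuous.comp
    (f := fun w => ((a, w) : (C.idx → ℝ) × C.W.lev 0)) (by fun_prop)
  obtain ⟨w, hwN, t, ht, rfl⟩ := (mem_closure_iff_nhds.1 (C.W.dense_smooth 0 b)) _
    (hι.continuousAt.preimage_mem_nhds hN)
  refine ⟨fun j => C.T.equiv j ((a, t j) : (C.idx → ℝ) × C.W.lev j), fun j => ?_, hwN, ?_⟩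
  · refine (C.T.comm j _).trans (congrArg (C.T.equiv j) ?_)
    exact Prod.ext rfl (ht j)
  · rw [C.coord_T, C.coord_T]

theorem degeneracy_congr (C : PartialQuadrant E) {x y : E.lev 0} (h : C.coord x = C.coord y) :
    C.degeneracy x = C.degeneracy y := by
  rw [degeneracy, degeneracy, h]

end PartialQuadrant

/-! ### Sc-derivatives and face planes -/

section FaceDerivative

variable {E : ScBanach.{u₁}} {F : ScBanach.{u₂}} {f : E.lev 0 → F.lev 0} {U : Set (E.lev 0)}
  {C : PartialQuadrant E} {C' : PartialQuadrant F}

theorem PartialQuadrant.IsRelOpen.eventually_line (hU : C.IsRelOpen U) {x v : E.lev 1}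
    (hx : E.incl 0 x ∈ U) (hv : E.incl 0 v ∈ C.facePlane (E.incl 0 x)) :
    ∀ᶠ t : ℝ in 𝓝 0, E.incl 0 (x + t • v) ∈ U := by
  obtain ⟨G, hG, rfl⟩ := hU
  have hc : Continuous fun t : ℝ => E.incl 0 (x + t • v) := by fun_prop
  have h1 : ∀ᶠ t : ℝ in 𝓝 0, E.incl 0 (x + t • v) ∈ G :=
    hc.continuousAt.preimage_mem_nhds (hG.mem_nhds (by simpa using hx.1))
  have h2 : ∀ i, ∀ᶠ t : ℝ in 𝓝 0, 0 ≤ C.coord (E.incl 0 (x + t • v)) i := fun i => by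
    have e : ∀ t : ℝ, C.coord (E.incl 0 (x + t • v)) i =
        C.coord (E.incl 0 x) i + t * C.coord (E.incl 0 v) i := fun t => by
      simp only [← C.coordL_apply, map_add, map_smul]; rfl
    simp only [e]
    -- Vanishing coordinates stay zero along v, and positive ones stay positive for small t of
    -- either sign.
    rcases (hx.2 i).eq_or_lt with h0 | h0
    · rw [hv i h0.symm, ← h0]; simp
    · have hc' : Continuous fun t : ℝ =>
        C.coord (E.incl 0 x) i + t * C.coord (E.incl 0 v) i := by fun_prop
      exact (hc'.continuousAt.eventually (lt_mem_nhds (by simpa using h0))).mono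
        fun _ h => le_of_lt h
  filter_upwards [h1, eventually_all.2 h2] with t ht ht'
  exact ⟨ht, ht'⟩

/-- The sc-derivative of a map between partial quadrants maps `E_x` to `F_{f(x)}`. -/
theorem HasScDerivAt.mapsTo_facePlane {x : E.lev 1} {D : E.lev 0 →L[ℝ] F.lev 0}
    (hD : HasScDerivAt f U x D) (hU : C.IsRelOpen U) (hx : E.incl 0 x ∈ U)
    (hm : MapsTo f U C'.carrier) :
    MapsTo D (C.facePlane (E.incl 0 x)) (C'.facePlane (f (E.incl 0 x))) := by
  intro v hv j hj
  have key : ∀ v₁ : E.lev 1, E.incl 0 v₁ ∈ C.facePlane (E.incl 0 x) →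
      C'.coordL (D (E.incl 0 v₁)) j = 0 := by
    intro v₁ hv₁
    have hl := hU.eventually_line hx hv₁
    have h1 : HasDerivAt (fun t : ℝ => x + t • v₁) v₁ 0 := by
      simpa using ((hasDerivAt_id (0 : ℝ)).smul_const v₁).const_add x
    have hD' : HasFDerivWithinAt (fun y : E.lev 1 => f (E.incl 0 y)) (D.comp (E.incl 0))
      (E.incl 0 ⁻¹' U) (x + (0 : ℝ) • v₁) := by rw [zero_smul, add_zero]; exact hD
    have h2 := (hD'.comp_hasDerivWithinAt (0 : ℝ) (h1.hasDerivWithinAt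
      (s := {t : ℝ | E.incl 0 (x + t • v₁) ∈ U})) fun t ht => ht).hasDerivAt hl
    have h3 := ((ContinuousLinearMap.proj (R := ℝ) (φ := fun _ : C'.idx => ℝ) j).comp
      C'.coordL).hasFDerivAt.comp_hasDerivAt (0 : ℝ) h2
    -- Fermat: the j-th coordinate of f along the line is nonnegative and vanishes at t = 0.
    refine IsLocalMin.hasDerivAt_eq_zero ?_ h3
    filter_upwards [hl] with t ht
    simp only [Function.comp_apply, zero_smul, add_zero]
    exact hj.le.trans (hm ht j)
  obtain ⟨⟨a, b⟩, rfl⟩ : ∃ z : (C.idx → ℝ) × C.W.lev 0, C.T.equiv 0 z = v :=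
    (C.T.equiv 0).surjective v
  -- Passage from directions in E_1 to all directions: W_1 is dense in W_0, and fixing the quadrant
  -- coordinates `a` keeps the approximating vectors in the face plane.
  have hc : Continuous fun w : C.W.lev 0 =>
      C'.coordL (D (C.T.equiv 0 ((a, w) : (C.idx → ℝ) × C.W.lev 0))) j :=
    (continuous_apply j).comp (C'.coordL.continuous.comp (D.continuous.comp
      ((C.T.equiv 0).continuous.comp
        (f := fun w => ((a, w) : (C.idx → ℝ) × C.W.lev 0)) (by fun_prop))))
  refine congrFun ((C.W.incl_denseRange 0).equalizer hc continuous_const (funext fun w => ?_)) b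
  have e : C.T.equiv 0 ((a, C.W.incl 0 w) : (C.idx → ℝ) × C.W.lev 0) =
      E.incl 0 (C.T.equiv 1 ((a, w) : (C.idx → ℝ) × C.W.lev 1)) := (C.T.comm 0 ((a, w) : (C.idx → ℝ) × C.W.lev 1)).symm
  simp only [Function.comp_apply, e]
  refine key _ fun i hi => ?_
  rw [← e, C.coord_T]
  have := hv i hi
  rwa [C.coord_T] at this

theorem ScCont.exists_smooth (hf : ScCont f U) {s : ∀ j, E.lev j}
    (hs : ∀ j, E.incl j (s (j + 1)) = s j) (hsU : s 0 ∈ U) :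
    ∃ t : ∀ j, F.lev j, (∀ j, F.incl j (t (j + 1)) = t j) ∧ t 0 = f (s 0) := by
  have h0 : ∀ j, E.toZero j (s j) = s 0 := fun j => by
    induction j with
    | zero => rfl
    | succ j ih => change E.toZero j (E.incl j (s (j + 1))) = _; rw [hs, ih]
  choose g _ hg using hf
  have ht : ∀ j, F.toZero j (g j (s j)) = f (s 0) := fun j => by
    rw [hg j (s j) (by change E.toZero j (s j) ∈ U; rwa [h0]), h0]
  exact ⟨fun j => g j (s j), fun j => F.toZero_injective j ((ht (j + 1)).trans (ht j).symm), ht 0⟩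

theorem IsScDirectSum.exists_add_eq {A B : Submodule ℝ (E.lev 0)} (h : IsScDirectSum E A B)
    (v : E.lev 0) : ∃ a ∈ A, ∃ b ∈ B, a + b = v :=
  Submodule.mem_sup.1 ((h 0).sup_eq_top.ge (Submodule.mem_top (x := v)))

end FaceDerivative

/-! ## The degeneracy index in tame charts -/

section Degeneracy

open ModelChart

variable {X : Type u₁} [TopologicalSpace X]

/-- The transition there and back is r, with derivative P. Tameness of c makes P surjective modulo
the face plane, and P factors through the quotient belonging to c'. Only c has to be tame. -/
theorem ModelChart.degeneracy_le_of_smoothPt {c c' : ModelChart.{u₁, u₂} X}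
    {U : Set (c.E.lev 0)} {r : c.E.lev 0 → c.E.lev 0} (hr : IsTameRetraction c.C U r)
    (ht : r '' U = c.e.target) (h : c.SmoothTransition c') (h' : c'.SmoothTransition c) {x : X}
    (hx : x ∈ c.e.source) (hx' : x ∈ c'.e.source) {o : c.E.lev 1} (ho : c.E.IsSmoothPt o)
    (hox : c.E.incl 0 o = c.e x) : c.C.degeneracy (c.e x) ≤ c'.C.degeneracy (c'.e x) := by
  obtain ⟨hr, -, htame⟩ := hr
  obtain ⟨U₂, r₂, hr₂, ht₂, hΨ⟩ := h'
  have hO : IsOpen (c.e.source ∩ c'.e.source) := c.open_source.inter c'.open_source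
  obtain ⟨h₀, -⟩ := restrict_param hr ht hO inter_subset_left
  set U₀ := U ∩ c.param r ⁻¹' (c.e.source ∩ c'.e.source) with hU₀
  have hΦ : ScSmooth (F := c'.E) (c'.e ∘ c.param r) U₀ :=
    ((isPlot_param (B := {c'}) hr ht (by rintro _ rfl; exact h)).2 c' rfl).mono
      fun y hy => ⟨hy.1, hy.2.2⟩
  have hΦm : MapsTo (c'.e ∘ c.param r) U₀ U₂ := fun y hy => by
    refine hr₂.image_subset ?_
    rw [ht₂]
    exact ⟨c.param r y, ⟨hy.2.2, hy.2.1⟩, rfl⟩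
  have hΨm : MapsTo ((c.e ∘ c'.e.symm) ∘ r₂) U₂ c.C.carrier := fun y hy => by
    have h1 : r₂ y ∈ c'.e '' (c'.e.source ∩ c.e.source) := ht₂ ▸ mem_image_of_mem _ hy
    obtain ⟨z, hz, hzy⟩ := h1
    refine hr.relOpen.subset_carrier ?_
    simp only [Function.comp_apply]
    rw [← hzy, c'.e.left_inv hz.1]
    exact mem_of_target hr ht hz.2
  have hcomp : EqOn (((c.e ∘ c'.e.symm) ∘ r₂) ∘ (c'.e ∘ c.param r)) r U₀ := fun y hy => by
    have h1 : r₂ (c'.e (c.param r y)) = c'.e (c.param r y) :=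
      hr₂.eq_of_mem_image (ht₂ ▸ ⟨c.param r y, ⟨hy.2.2, hy.2.1⟩, rfl⟩)
    simp only [Function.comp_apply]
    rw [h1, c'.e.left_inv hy.2.2, e_param ht hy.1]
  have hoU : c.E.incl 0 o ∈ U := hox ▸ mem_of_target hr ht hx
  have hpo : c.param r (c.E.incl 0 o) = x := by rw [hox, param_e hr ht hx]
  have hoU₀ : c.E.incl 0 o ∈ U₀ := ⟨hoU, by
    change c.param r _ ∈ c.e.source ∩ c'.e.source
    rw [hpo]; exact ⟨hx, hx'⟩⟩
  obtain ⟨y, hy⟩ := hΦ.exists_lift hoU₀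
  have hyx : c'.E.incl 0 y = c'.e x := by rw [hy, Function.comp_apply, hpo]
  have hyU : c'.E.incl 0 y ∈ U₂ := hy ▸ hΦm hoU₀
  obtain ⟨D, hD⟩ := hΦ.exists_hasScDerivAt hoU₀
  obtain ⟨D', hD'⟩ := hΨ.exists_hasScDerivAt hyU
  obtain ⟨P, hP, A, -, hPA, hA⟩ := htame o ho (hox ▸ ht ▸ c.e.map_source hx)
  have hch := hD'.comp_of_scSmooth hD hΨ hΦ hr₂.isScDomain hΦm hoU₀ hy
  have e : D'.comp D = P := hch.unique h₀.isScDomain hoU₀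
    ((hP.mono inter_subset_left).congr hcomp hoU₀)
  have hf := hD.mapsTo_facePlane (C' := c'.C) h₀.relOpen hoU₀
    fun y hy => hr₂.relOpen.subset_carrier (hΦm hy)
  have hf' := hD'.mapsTo_facePlane (C' := c.C) hr₂.relOpen hyU hΨm
  have hΨy : ((c.e ∘ c'.e.symm) ∘ r₂) (c'.E.incl 0 y) = c.E.incl 0 o := by
    rw [hy]
    exact (hcomp hoU₀).trans (hr.eq_of_mem_image (hox ▸ ht ▸ c.e.map_source hx))
  rw [hΨy] at hf'
  rw [← hy] at hf
  rw [← hox, ← hyx]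
  refine PartialQuadrant.degeneracy_le_of_factor hf hf' fun v => ?_
  obtain ⟨_, ⟨w, rfl⟩, a, ha, hv⟩ := hPA.exists_add_eq v
  exact ⟨w, a, hA ha, by rw [← hv, ← e]; rfl⟩

/-- Approximation by smooth points: they can be chosen with the same degeneracy in c, while the
degeneracy in c' cannot increase under small perturbations. -/
theorem ModelChart.degeneracy_le {c c' : ModelChart.{u₁, u₂} X}
    (hc : IsTameRetract c.C c.e.target) (h : c.SmoothTransition c') (h' : c'.SmoothTransition c)
    {x : X} (hx : x ∈ c.e.source) (hx' : x ∈ c'.e.source) :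
    c.C.degeneracy (c.e x) ≤ c'.C.degeneracy (c'.e x) := by
  obtain ⟨U, r, hr, ht⟩ := hc
  have hO : IsOpen (c.e.source ∩ c'.e.source) := c.open_source.inter c'.open_source
  obtain ⟨h₀, -⟩ := restrict_param hr.1 ht hO inter_subset_left
  set U₀ := U ∩ c.param r ⁻¹' (c.e.source ∩ c'.e.source) with hU₀
  have hcont : ContinuousOn (c'.e ∘ c.param r) U₀ :=
    c'.continuousOn_toFun.comp ((continuousOn_param hr.1 ht).mono inter_subset_left)
      fun y hy => hy.2.2
  have hpx : c.param r (c.e x) = x := param_e hr.1 ht hx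
  have hxU₀ : c.e x ∈ U₀ := ⟨mem_of_target hr.1 ht hx, by
    change c.param r (c.e x) ∈ c.e.source ∩ c'.e.source
    rw [hpx]; exact ⟨hx, hx'⟩⟩
  have hev : ∀ᶠ y in 𝓝[U₀] (c.e x),
      c'.C.degeneracy (c'.e (c.param r y)) ≤ c'.C.degeneracy (c'.e x) := by
    have h1 := hcont (c.e x) hxU₀
    rw [ContinuousWithinAt, Function.comp_apply, hpx] at h1
    exact h1.eventually (c'.C.eventually_degeneracy_le (c'.e x))
  obtain ⟨G, hG, hGU⟩ := h₀.relOpen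
  rw [hGU] at hev
  obtain ⟨N, hN, hNG⟩ := mem_nhdsWithin_iff_exists_mem_nhds_inter.1 hev
  have hxG : c.e x ∈ G ∩ c.C.carrier := hGU ▸ hxU₀
  obtain ⟨s, hs, hsN, hsc⟩ := c.C.exists_smooth_coord_eq (inter_mem hN (hG.mem_nhds hxG.1))
  have hsG : s 0 ∈ G ∩ c.C.carrier := ⟨hsN.2, fun i => by rw [hsc]; exact hxG.2 i⟩
  have hsU₀ : s 0 ∈ U₀ := hGU ▸ hsG
  -- The point s 0 need not lie on the retract. Its image r (s 0) does, is still smooth, and by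
  -- tameness has the same degeneracy.
  obtain ⟨t, hts, ht0⟩ := (hr.1.smooth 0).scCont.exists_smooth hs hsU₀.1
  have hcp : c.e (c.param r (s 0)) = r (s 0) := e_param ht hsU₀.1
  have h2 := degeneracy_le_of_smoothPt hr ht h h' hsU₀.2.1 hsU₀.2.2 (o := t 1) ⟨t, hts, rfl⟩
    (by rw [hts, ht0, hcp])
  rw [hcp, hr.2.1 _ hsU₀.1, c.C.degeneracy_congr hsc] at h2
  exact h2.trans (hNG ⟨hsN.1, hsG⟩)

namespace MPolyfold

variable {S S' : MPolyfold.{u₁, u₂} X}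

theorem isChart_of_mem {c : ModelChart.{u₁, u₂} X} (hc : c ∈ S.charts) : S.IsChart c :=
  ⟨S.retract c hc, fun c' hc' => ⟨S.compat c hc c' hc', S.compat c' hc' c hc⟩⟩

theorem Equivalent.symm (h : S.Equivalent S') : S'.Equivalent S :=
  fun c hc c' hc' => (h c' hc' c hc).symm

theorem Equivalent.isPlot (h : S.Equivalent S') {E : ScBanach.{u₃}} {U : Set (E.lev 0)}
    {α : E.lev 0 → X} (hU : IsScDomain U) (hα : IsPlot S.charts U α) : IsPlot S'.charts U α :=
  hα.change hU S.cover fun c hc d hd => (h c hc d hd).1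

theorem IsChart.isPlot_param {c : ModelChart.{u₁, u₂} X} (hc : S.IsChart c)
    {V : Set (c.E.lev 0)} {r : c.E.lev 0 → c.E.lev 0}
    (hr : IsScRetraction c.C V r) (ht : r '' V = c.e.target) : IsPlot S.charts V (c.param r) :=
  ModelChart.isPlot_param hr ht fun d hd => (hc.2 d hd).1

theorem IsChart.isPlot_singleton {c : ModelChart.{u₁, u₂} X} (hc : S.IsChart c)
    {E : ScBanach.{u₃}} {U : Set (E.lev 0)} {α : E.lev 0 → X} (hU : IsScDomain U)
    (hα : IsPlot S.charts U α) : IsPlot {c} U α :=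
  hα.change hU S.cover fun d hd c' hc' => by
    rw [mem_singleton_iff.1 hc']; exact (hc.2 d hd).2

theorem IsChart.smoothTransition {c c' : ModelChart.{u₁, u₂} X} (hc : S.IsChart c)
    (hc' : S.IsChart c') : c.SmoothTransition c' := by
  obtain ⟨V, r, hr, ht⟩ := hc.1
  exact ModelChart.smoothTransition_of_isPlot hr ht
    (hc'.isPlot_singleton hr.isScDomain (hc.isPlot_param hr ht)) rfl

theorem IsChart.of_equivalent {c : ModelChart.{u₁, u₂} X} (hc : S.IsChart c)
    (h : S.Equivalent S') : S'.IsChart c :=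
  ⟨hc.1, fun c' hc' => by
    have h1 : S.IsChart c' := ⟨S'.retract c' hc', fun d hd => (h d hd c' hc').symm⟩
    exact ⟨hc.smoothTransition h1, h1.smoothTransition hc⟩⟩

theorem Equivalent.degeneracy_eq (h : S.Equivalent S') (x : X) :
    S.degeneracy x = S'.degeneracy x := by
  have e : ∀ c, S.IsChart c ↔ S'.IsChart c := fun c =>
    ⟨fun hc => hc.of_equivalent h, fun hc => hc.of_equivalent h.symm⟩
  simp only [degeneracy, e]

/-- Tame charts compute the degeneracy index. -/
theorem IsChart.degeneracy_eq {c : ModelChart.{u₁, u₂} X} (hc : S.IsChart c)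
    (ht : IsTameRetract c.C c.e.target) {x : X} (hx : x ∈ c.e.source) :
    S.degeneracy x = c.C.degeneracy (c.e x) := by
  refine le_antisymm (Nat.sInf_le ⟨c, hc, hx, rfl⟩) (le_csInf ⟨_, c, hc, hx, rfl⟩ ?_)
  rintro k ⟨c', hc', hx', rfl⟩
  exact ModelChart.degeneracy_le ht (hc.smoothTransition hc') (hc'.smoothTransition hc) hx hx'

end MPolyfold

/-- The identity of a relatively open subset of a partial quadrant is a tame retraction. -/
theorem PartialQuadrant.IsRelOpen.isTameRetraction {E : ScBanach.{u₁}} {C : PartialQuadrant E}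
    {U : Set (E.lev 0)} (hU : C.IsRelOpen U) : IsTameRetraction C U id := by
  refine ⟨⟨hU, mapsTo_id U, (ScOp.id E).scSmooth U, fun _ _ => rfl⟩, fun _ _ => rfl,
    fun x _ _ => ⟨ContinuousLinearMap.id ℝ _, (ScOp.id E).hasScDerivAt U x, ⊥, ?_, ?_, ?_⟩⟩
  · refine ⟨isClosed_singleton, fun i y hy => subset_closure ⟨hy, ?_⟩⟩
    have : y = 0 := E.toZero_injective i ((show E.toZero i y = 0 from hy).trans (map_zero _).symm)
    exact ⟨fun _ => 0, fun _ => map_zero _, this.symm⟩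
  · intro i
    have h1 : LinearMap.range (ContinuousLinearMap.id ℝ (E.lev 0)).toLinearMap = ⊤ :=
      LinearMap.range_id
    have h2 : (⊥ : Submodule ℝ (E.lev 0)).comap (E.toZero i).toLinearMap = ⊥ :=
      LinearMap.ker_eq_bot.2 (E.toZero_injective i)
    rw [h1, h2, Submodule.comap_top]
    exact isCompl_top_bot
  · intro v hv i _
    rw [show v = 0 from hv]
    exact congrFun (map_zero C.coordL) i

end Degeneracy

/-! ## Sc-complements -/

section Complements

variable {E : ScBanach.{u₁}} {F : ScBanach.{u₂}}

theorem ScBanach.IsSmoothPt.add {i : ℕ} {x y : E.lev i} (hx : E.IsSmoothPt x)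
    (hy : E.IsSmoothPt y) : E.IsSmoothPt (x + y) := by
  obtain ⟨s, hs, rfl⟩ := hx
  obtain ⟨t, ht, rfl⟩ := hy
  exact ⟨fun j => s j + t j, fun j => by rw [map_add, hs, ht], rfl⟩

theorem ScBanach.IsSmoothPt.sub {i : ℕ} {x y : E.lev i} (hx : E.IsSmoothPt x)
    (hy : E.IsSmoothPt y) : E.IsSmoothPt (x - y) := by
  obtain ⟨s, hs, rfl⟩ := hx
  obtain ⟨t, ht, rfl⟩ := hy
  exact ⟨fun j => s j - t j, fun j => by rw [map_sub, hs, ht], rfl⟩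

theorem ScBanach.IsSmoothPt.map {i : ℕ} {x : E.lev i} (hx : E.IsSmoothPt x) (L : ScOp E F) :
    F.IsSmoothPt (L.map i x) := by
  obtain ⟨s, hs, rfl⟩ := hx
  exact ⟨fun j => L.map j (s j), fun j => by rw [L.comm, hs], rfl⟩

/-- If `Q ≤ P` are sc-projections and `A` is an sc-complement of the range of `P`, then
`(P - Q) E ⊕ A` is an sc-complement of the range of `Q`. -/
theorem exists_scComplement {P Q : ScOp E E} (hPP : ∀ v, P.map 0 (P.map 0 v) = P.map 0 v)
    (hQQ : ∀ v, Q.map 0 (Q.map 0 v) = Q.map 0 v) (hPQ : ∀ v, P.map 0 (Q.map 0 v) = Q.map 0 v)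
    (hQP : ∀ v, Q.map 0 (P.map 0 v) = Q.map 0 v)
    {A : Submodule ℝ (E.lev 0)} (hA : IsScSubspace E A)
    (hPA : IsScDirectSum E (LinearMap.range (P.map 0).toLinearMap) A) :
    ∃ A' : Submodule ℝ (E.lev 0), IsScSubspace E A' ∧
      IsScDirectSum E (LinearMap.range (Q.map 0).toLinearMap) A' ∧
      ∀ v ∈ A', ∃ w, ∃ a ∈ A, P.map 0 w - Q.map 0 w + a = v := by
  set R := LinearMap.range (P.map 0).toLinearMap with hR
  have hfix : ∀ v ∈ R, P.map 0 v = v := by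
    rintro _ ⟨w, rfl⟩
    exact hPP w
  have hRc : IsClosed (R : Set (E.lev 0)) := by
    have e : (R : Set (E.lev 0)) = {v | P.map 0 v = v} :=
      Set.ext fun v => ⟨hfix v, fun h => ⟨v, h⟩⟩
    rw [e]
    exact isClosed_eq (P.map 0).continuous continuous_id
  have hcompl : IsCompl R A := hPA 0
  -- Closed algebraic complements in a Banach space have a continuous projection.
  have htop := Submodule.IsCompl.isTopCompl_of_isClosed hcompl hRc hA.1
  set π := R.projectionL A htop with hπ
  have hπR : ∀ v ∈ R, π v = v := fun v hv => R.projectionL_apply_left htop ⟨v, hv⟩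
  have hπA : ∀ v ∈ A, π v = 0 := fun v hv => (R.projectionL_apply_eq_zero_iff htop).2 hv
  have hQR : ∀ v, Q.map 0 v ∈ R := fun v => ⟨Q.map 0 v, hPQ v⟩
  have hsplit : ∀ i (e : E.lev i), ∃ a b : E.lev i, E.toZero i a ∈ R ∧ E.toZero i b ∈ A ∧
      a + b = e := fun i e => by
    obtain ⟨a, ha, b, hb, h⟩ := Submodule.mem_sup.1
      ((hPA i).sup_eq_top.ge (Submodule.mem_top (x := e)))
    exact ⟨a, b, ha, hb, h⟩
  -- As a kernel, (P - Q)E ⊕ A is visibly closed.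
  let A' : Submodule ℝ (E.lev 0) := LinearMap.ker ((Q.map 0).comp π).toLinearMap
  have hA' : ∀ v, v ∈ A' ↔ Q.map 0 (π v) = 0 := fun v => Iff.rfl
  refine ⟨A', ⟨((Q.map 0).comp π).isClosed_ker, fun i e he => ?_⟩, fun i => ?_, fun v hv => ?_⟩
  · obtain ⟨a, b, ha, hb, rfl⟩ := hsplit i e
    have hQa : Q.map 0 (E.toZero i a) = 0 := by
      have h := (hA' _).1 he
      rwa [map_add, map_add, hπR _ ha, hπA _ hb, add_zero] at h
    -- Applying P - Q to smooth approximations of `a` therefore gives smooth approximations inside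
    -- A'.
    have haa : (P.map i - Q.map i) a = a := E.toZero_injective i (by
      rw [sub_apply, map_sub, P.toZero_map, Q.toZero_map, hQa, hfix _ ha,
        sub_zero])
    have h1 := map_mem_closure (P.map i - Q.map i).continuous (E.dense_smooth i a)
      (t := {x : E.lev i | x ∈ E.levelSet (A' : Set (E.lev 0)) i ∧ E.IsSmoothPt x})
      fun x hx => by
        have hx' : E.IsSmoothPt x := hx
        refine ⟨?_, (hx'.map P).sub (hx'.map Q)⟩
        change E.toZero i (P.map i x - Q.map i x) ∈ A'
        have hPR : P.map 0 (E.toZero i x) ∈ R := ⟨_, rfl⟩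
        rw [map_sub, P.toZero_map, Q.toZero_map, hA', map_sub, hπR _ hPR, hπR _ (hQR _),
          map_sub, hQP, hQQ, sub_self]
    rw [haa] at h1
    refine map_mem_closure₂ continuous_add h1 (hA.2 i hb) fun x hx y hy => ⟨?_, hx.2.add hy.2⟩
    change E.toZero i (x + y) ∈ A'
    have hyA : E.toZero i y ∈ A := hy.1
    rw [map_add]
    refine A'.add_mem hx.1 ?_
    rw [hA', hπA _ hyA, map_zero]
  · refine isCompl_iff.2 ⟨?_, ?_⟩
    · rw [Submodule.disjoint_def]
      rintro e ⟨w, hw⟩ he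
      have hw' : Q.map 0 w = E.toZero i e := hw
      have he' : Q.map 0 (π (E.toZero i e)) = 0 := he
      rw [← hw', hπR _ (hQR w), hQQ, hw'] at he'
      exact E.toZero_injective i (he'.trans (map_zero _).symm)
    · rw [codisjoint_iff, eq_top_iff]
      intro e _
      obtain ⟨a, b, ha, hb, rfl⟩ := hsplit i e
      refine Submodule.mem_sup.2 ⟨Q.map i a, ⟨E.toZero i a, (Q.toZero_map i a).symm⟩,
        a - Q.map i a + b, ?_, by abel⟩
      change Q.map 0 (π (E.toZero i (a - Q.map i a + b))) = 0
      rw [map_add, map_add, hπA _ hb, add_zero, map_sub, Q.toZero_map,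
        hπR _ (R.sub_mem ha (hQR _)), map_sub, hQQ, sub_self]
  · have hv' : Q.map 0 (π v) = 0 := hv
    refine ⟨π v, v - π v, ?_, ?_⟩
    · rw [← R.projectionL_apply_eq_zero_iff htop, map_sub, ← hπ,
        hπR (π v) (R.projectionL_apply_mem htop v), sub_self]
    · rw [hv', hfix _ (R.projectionL_apply_mem htop v)]
      abel

end Complements

open ModelChart

/-! ## Submersions have surjective derivatives -/

section Submersions

variable {X : Type u₁} [TopologicalSpace X] {V : Type u₃} [TopologicalSpace V]
  {S : MPolyfold.{u₁, u₂} X} {R : MPolyfold.{u₃, u₄} V}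

theorem ModelChart.isPlot_symm {d : ModelChart.{u₃, u₄} V} (hd : d ∈ R.charts)
    (hdo : d.C.IsRelOpen d.e.target) : IsPlot R.charts d.e.target d.e.symm :=
  R.isScAtlas.isPlot_param hd hdo.isTameRetraction.1 (image_id _)

/-- The first component of ρ is a smooth family x' = β(x, v) with p(β(x, v)) = v. Differentiating in
charts at a point of the graph gives L ∘ D = projection to the second factor, so w ↦ D(0, w) is a
right inverse of L. -/
theorem MPolyfold.HasSubmersionProperty.surjective_scDeriv {p : X → V} (hp : S.Smooth R p)
    (hsub : S.HasSubmersionProperty R p) {c : ModelChart.{u₁, u₂} X} (hc : c ∈ S.charts)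
    {U : Set (c.E.lev 0)} {r : c.E.lev 0 → c.E.lev 0} (hr : IsScRetraction c.C U r)
    (ht : r '' U = c.e.target) {d : ModelChart.{u₃, u₄} V} (hd : d ∈ R.charts)
    (hdo : d.C.IsRelOpen d.e.target) {o : c.E.lev 1} (ho : c.E.incl 0 o ∈ c.e.target)
    (hod : p (c.param r (c.E.incl 0 o)) ∈ d.e.source) {L : c.E.lev 0 →L[ℝ] d.E.lev 0}
    (hL : HasScDerivAt (F := d.E) (d.e ∘ p ∘ c.param r)
      (U ∩ (p ∘ c.param r) ⁻¹' d.e.source) o L) : Function.Surjective L := by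
  have hπ := S.isScAtlas.isPlot_param hc hr ht
  have hpπ : IsPlot R.charts U (p ∘ c.param r) :=
    hπ.map hr.isScDomain S.cover hp (mapsTo_univ _ _)
  have hf := hpπ.2 d hd
  have hUf := hpπ.isScDomain_inter hr.isScDomain d.open_source
  have hoU : c.E.incl 0 o ∈ U := hr.image_subset (ht ▸ ho)
  obtain ⟨z, hz⟩ := hf.exists_lift ⟨hoU, hod⟩
  obtain ⟨N, hN, hxN, ρ, hρN, hρ, hρ2, hρρ, hρim⟩ := hsub.2 (c.param r (c.E.incl 0 o))
  have hgraph : ∀ q ∈ N, p q.1 = q.2 → ρ q = q := fun q hq hpq => by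
    have h1 : q ∈ ρ '' N := hρim ▸ ⟨hq, hpq⟩
    obtain ⟨q', hq', rfl⟩ := h1
    exact hρρ q' hq'
  let M := U ×ˢ d.e.target
  have hM : IsScDomain (A := (c.E.prod d.E).lev 0) M :=
    (hr.prod hdo.isTameRetraction.1).isScDomain
  let γ : (c.E.prod d.E).lev 0 → X × V := fun m =>
    ((c.param r ∘ (ScOp.fst c.E d.E).map 0) m, (d.e.symm ∘ (ScOp.snd c.E d.E).map 0) m)
  have hγ : IsPlot (prodCharts S.charts R.charts) M γ :=
    (hπ.comp hr.isScDomain ((ScOp.fst c.E d.E).scSmooth M) fun m hm => hm.1).prodMk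
      ((isPlot_symm hd hdo).comp hdo.isScDomain ((ScOp.snd c.E d.E).scSmooth M) fun m hm => hm.2)
  have hγN := hγ.isScDomain_inter hM hN
  have hργ : IsPlot (prodCharts S.charts R.charts) (M ∩ γ ⁻¹' N) (ρ ∘ γ) :=
    (hγ.mono inter_subset_left).map hγN (S.isScAtlas.prod R.isScAtlas).cover hρ fun m hm => hm.2
  have hβ := hργ.fst hγN R.cover
  set β : (c.E.prod d.E).lev 0 → X := fun m => ((ρ ∘ γ) m).1 with hβdef
  have hM₂ := hβ.isScDomain_inter hγN c.open_source
  have hΞ := hβ.2 c hc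
  set M₂ := M ∩ γ ⁻¹' N ∩ β ⁻¹' c.e.source with hM₂def
  have hpβ : ∀ m ∈ M₂, p (β m) = d.e.symm m.2 := fun m hm => by
    have h1 : ρ (γ m) ∈ N ∩ {q | p q.1 = q.2} := hρim ▸ mem_image_of_mem ρ hm.1.2
    exact h1.2.trans (hρ2 _ hm.1.2)
  have hΞm : MapsTo (c.e ∘ β) M₂ (U ∩ (p ∘ c.param r) ⁻¹' d.e.source) := fun m hm => by
    refine ⟨mem_of_target hr ht hm.2, ?_⟩
    change p (c.param r (c.e (β m))) ∈ d.e.source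
    rw [param_e hr ht hm.2, hpβ m hm]
    exact d.e.map_target hm.1.1.2
  have hcomp : EqOn ((ScOp.snd c.E d.E).map 0) ((d.e ∘ p ∘ c.param r) ∘ (c.e ∘ β)) M₂ :=
    fun m hm => by
      simp only [Function.comp_apply]
      rw [param_e hr ht hm.2, hpβ m hm, d.e.right_inv hm.1.1.2]
      rfl
  -- The base point on the graph, on level 1; ρ fixes it, so the inner map sends it back to o, where
  -- L is taken.
  let m₀ : (c.E.prod d.E).lev 1 := ((o, z) : c.E.lev 1 × d.E.lev 1)
  have hro : r (c.E.incl 0 o) = c.E.incl 0 o := hr.eq_of_mem_image (ht ▸ ho)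
  have hγm₀ : γ ((c.E.prod d.E).incl 0 m₀) =
      (c.param r (c.E.incl 0 o), p (c.param r (c.E.incl 0 o))) := by
    refine Prod.ext rfl ?_
    change d.e.symm (d.E.incl 0 z) = _
    rw [hz]
    exact d.e.left_inv hod
  have hβm₀ : β ((c.E.prod d.E).incl 0 m₀) = c.param r (c.E.incl 0 o) := by
    change (ρ (γ _)).1 = _
    rw [hγm₀, hgraph _ hxN rfl]
  have hm₀ : (c.E.prod d.E).incl 0 m₀ ∈ M₂ := by
    refine ⟨⟨⟨hoU, ?_⟩, ?_⟩, ?_⟩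
    · change d.E.incl 0 z ∈ d.e.target
      rw [hz]
      exact d.e.map_source hod
    · change γ _ ∈ N
      rwa [hγm₀]
    · change β _ ∈ c.e.source
      rw [hβm₀]
      exact mapsTo_param ht hoU
  obtain ⟨D, hD⟩ := hΞ.exists_hasScDerivAt hm₀
  have hch := hL.comp_of_scSmooth hD hf hΞ hUf hΞm hm₀ (by
    rw [Function.comp_apply, hβm₀, e_param ht hoU, hro])
  have e := (hch.congr hcomp hm₀).unique hM₂ hm₀ ((ScOp.snd c.E d.E).hasScDerivAt M₂ m₀)
  intro w
  refine ⟨D ((0, w) : c.E.lev 0 × d.E.lev 0), ?_⟩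
  exact DFunLike.congr_fun e ((0, w) : c.E.lev 0 × d.E.lev 0)

end Submersions

/-! ## The structure induced by an imprinting -/

section Imprinting

variable {X : Type u₁} [TopologicalSpace X] {Y : Type u₃} [TopologicalSpace Y]
  {V : Type u₄} [TopologicalSpace V] {A : Set (ModelChart.{u₁, u₂} X)} {oplus : X → Y}

/-- A local section of `oplus` as in the definition of an imprinting. -/
structure IsImprintingSection (A : Set (ModelChart.{u₁, u₂} X)) (oplus : X → Y) (N : Set Y)
    (H : Y → X) : Prop where
  quotient : IsQuotientMap oplus
  isOpen : IsOpen N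
  right_inv : ∀ y ∈ N, oplus (H y) = y
  smooth : ScSmoothMapOn A A (H ∘ oplus) (oplus ⁻¹' N)

namespace IsImprintingSection

variable {N : Set Y} {H : Y → X}

theorem continuousOn (h : IsImprintingSection A oplus N H) : ContinuousOn H N :=
  (h.quotient.continuousOn_isOpen_iff h.isOpen).2 h.smooth.1

/-- The chart of `Y` obtained from a chart of `X` and a local section. -/
def chart (h : IsImprintingSection A oplus N H) (c : ModelChart.{u₁, u₂} X) :
    ModelChart.{u₃, u₂} Y where
  E := c.E
  C := c.C
  e :=
    { toFun := c.e ∘ H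
      invFun := oplus ∘ c.e.symm
      source := N ∩ H ⁻¹' c.e.source
      target := {o | o ∈ c.e.target ∧ oplus (c.e.symm o) ∈ N ∧
        H (oplus (c.e.symm o)) = c.e.symm o}
      map_source' := fun y hy => by
        have e : c.e.symm (c.e (H y)) = H y := c.e.left_inv hy.2
        refine ⟨c.e.map_source hy.2, ?_, ?_⟩
        · rw [Function.comp_apply, e, h.right_inv y hy.1]; exact hy.1
        · rw [Function.comp_apply, e, h.right_inv y hy.1]
      map_target' := fun o ho => ⟨ho.2.1, by
        change H (oplus (c.e.symm o)) ∈ c.e.source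
        rw [ho.2.2]; exact c.e.map_target ho.1⟩
      left_inv' := fun y hy => by
        simp only [Function.comp_apply]
        rw [c.e.left_inv hy.2, h.right_inv y hy.1]
      right_inv' := fun o ho => by
        simp only [Function.comp_apply]
        rw [ho.2.2, c.e.right_inv ho.1] }
  open_source := h.continuousOn.isOpen_inter_preimage h.isOpen c.open_source
  continuousOn_toFun := c.continuousOn_toFun.comp (h.continuousOn.mono inter_subset_left)
    fun _ hy => hy.2
  continuousOn_invFun := h.quotient.continuous.comp_continuousOn
    (c.continuousOn_invFun.mono fun _ ho => ho.1)

variable {c : ModelChart.{u₁, u₂} X} {U : Set (c.E.lev 0)} {r : c.E.lev 0 → c.E.lev 0}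

/-- The domain of the retraction onto the image of `h.chart c`. -/
def domain (oplus : X → Y) (N : Set Y) (H : Y → X) (c : ModelChart.{u₁, u₂} X)
    (U : Set (c.E.lev 0)) (r : c.E.lev 0 → c.E.lev 0) : Set (c.E.lev 0) :=
  U ∩ c.param r ⁻¹' (oplus ⁻¹' N ∩ (H ∘ oplus) ⁻¹' c.e.source)

/-- The retraction onto the image of `h.chart c`. -/
def retraction (oplus : X → Y) (H : Y → X) (c : ModelChart.{u₁, u₂} X)
    (r : c.E.lev 0 → c.E.lev 0) : c.E.lev 0 → c.E.lev 0 :=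
  c.e ∘ (H ∘ oplus) ∘ c.param r

/-- The retraction moves points only within fibres of `oplus`; its idempotence follows from this. -/
theorem oplus_param_retraction (h : IsImprintingSection A oplus N H)
    (hr : IsScRetraction c.C U r)
    (ht : r '' U = c.e.target) {u : c.E.lev 0} (hu : u ∈ domain oplus N H c U r) :
    oplus (c.param r (retraction oplus H c r u)) = oplus (c.param r u) := by
  have e : c.param r (retraction oplus H c r u) = H (oplus (c.param r u)) := param_e hr ht hu.2.2
  rw [e, h.right_inv _ hu.2.1]

theorem isScRetraction (h : IsImprintingSection A oplus N H)
    (hA : IsScAtlas A) (hc : c ∈ A) (hr : IsScRetraction c.C U r)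
    (ht : r '' U = c.e.target) :
    IsScRetraction c.C (domain oplus N H c U r) (retraction oplus H c r) where
  relOpen := by
    have hO : IsOpen (oplus ⁻¹' N ∩ (H ∘ oplus) ⁻¹' c.e.source) :=
      h.smooth.1.isOpen_inter_preimage (h.isOpen.preimage h.quotient.continuous) c.open_source
    obtain ⟨G, hG, e⟩ := exists_isOpen_inter_preimage (continuousOn_param hr ht) hO
    rw [domain, e]
    exact hr.relOpen.inter_open hG
  mapsTo u hu := by
    have e := h.oplus_param_retraction hr ht hu
    refine ⟨mem_of_target hr ht hu.2.2, ?_, ?_⟩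
    · change oplus (c.param r (retraction oplus H c r u)) ∈ N
      rw [e]; exact hu.2.1
    · change H (oplus (c.param r (retraction oplus H c r u))) ∈ c.e.source
      rw [e]; exact hu.2.2
  smooth := by
    have hπ := hA.isPlot_param hc hr ht
    have hN : IsOpen (oplus ⁻¹' N) := h.isOpen.preimage h.quotient.continuous
    have hHπ := (hπ.mono inter_subset_left).map (hπ.isScDomain_inter hr.isScDomain hN) hA.cover
      h.smooth fun u hu => hu.2
    exact (hHπ.2 c hc).mono fun u hu => ⟨⟨hu.1, hu.2.1⟩, hu.2.2⟩
  idem u hu := by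
    have e := h.oplus_param_retraction hr ht hu
    change c.e (H (oplus (c.param r (retraction oplus H c r u)))) = c.e (H (oplus (c.param r u)))
    rw [e]

theorem image_retraction (h : IsImprintingSection A oplus N H)
    (hr : IsScRetraction c.C U r)
    (ht : r '' U = c.e.target) :
    retraction oplus H c r '' domain oplus N H c U r = (h.chart c).e.target := by
  apply Subset.antisymm
  · rintro _ ⟨u, hu, rfl⟩
    exact (h.chart c).e.map_source (x := oplus (c.param r u)) ⟨hu.2.1, hu.2.2⟩
  · rintro o ⟨ho, hoN, hoH⟩
    have hro : r o = o := hr.eq_of_mem_image (ht ▸ ho)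
    have hpo : c.param r o = c.e.symm o := by rw [param, Function.comp_apply, hro]
    refine ⟨o, ⟨hr.image_subset (ht ▸ ho), ?_, ?_⟩, ?_⟩
    · change oplus (c.param r o) ∈ N
      rwa [hpo]
    · change H (oplus (c.param r o)) ∈ c.e.source
      rw [hpo, hoH]; exact c.e.map_target ho
    · change c.e (H (oplus (c.param r o))) = o
      rw [hpo, hoH, c.e.right_inv ho]

theorem chart_param_retraction (h : IsImprintingSection A oplus N H) {u : c.E.lev 0} (hu : u ∈ domain oplus N H c U r) :
    (h.chart c).param (retraction oplus H c r) u = oplus (c.param r u) := by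
  change oplus (c.e.symm (c.e (H (oplus (c.param r u))))) = _
  have e : c.e.symm (c.e (H (oplus (c.param r u)))) = H (oplus (c.param r u)) :=
    c.e.left_inv hu.2.2
  rw [e, h.right_inv _ hu.2.1]

end IsImprintingSection

/-- The charts of `Y` given by the charts of `X` and the local sections of `oplus`. -/
def imprintingCharts (A : Set (ModelChart.{u₁, u₂} X)) (oplus : X → Y) :
    Set (ModelChart.{u₃, u₂} Y) :=
  {q | ∃ c ∈ A, ∃ (N : Set Y) (H : Y → X) (h : IsImprintingSection A oplus N H), q = h.chart c}

variable {E : ScBanach.{u₅}} {U : Set (E.lev 0)}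

/-- In a chart φ ∘ H of Y the composite reads φ ∘ (H ∘ ⊕) ∘ α, and H ∘ ⊕ is sc-smooth by the
imprinting condition. -/
theorem IsPlot.oplus_comp (hA : IsScAtlas A) (ho : IsQuotientMap oplus) {α : E.lev 0 → X}
    (hU : IsScDomain U) (hα : IsPlot A U α) :
    IsPlot (imprintingCharts A oplus) U (oplus ∘ α) := by
  refine ⟨ho.continuous.comp_continuousOn hα.1, ?_⟩
  rintro _ ⟨c, hc, N, H, h, rfl⟩
  have hN : IsOpen (oplus ⁻¹' N) := h.isOpen.preimage ho.continuous
  have hHα := (hα.mono inter_subset_left).map (hα.isScDomain_inter hU hN) hA.cover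
    h.smooth fun u hu => hu.2
  exact (hHα.2 c hc).mono fun u hu => ⟨⟨hu.1, hu.2.1⟩, hu.2.2⟩

theorem IsImprintingSection.isPlot_comp {N : Set Y} {H : Y → X}
    (h : IsImprintingSection A oplus N H) {α : E.lev 0 → Y}
    (hα : IsPlot (imprintingCharts A oplus) U α) (hm : MapsTo α U N) : IsPlot A U (H ∘ α) :=
  ⟨h.continuousOn.comp hα.1 hm, fun c hc =>
    (hα.2 (h.chart c) ⟨c, hc, N, H, h, rfl⟩).mono fun _ hu => ⟨hu.1, hm hu.1, hu.2⟩⟩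

/-- The M-polyfold structure induced by an imprinting. -/
def imprintingStructure (S : MPolyfold.{u₁, u₂} X) (oplus : X → Y) (ho : S.IsImprinting oplus) :
    MPolyfold.{u₃, u₂} Y where
  t2 := by
    have := ho.2.1
    let := TopologicalSpace.metrizableSpaceMetric Y
    infer_instance
  paracompact := by
    have := ho.2.1
    let := TopologicalSpace.metrizableSpaceMetric Y
    infer_instance
  charts := imprintingCharts S.charts oplus
  retract := by
    rintro _ ⟨c, hc, N, H, h, rfl⟩
    obtain ⟨U, r, hr, ht⟩ := S.retract c hc
    exact ⟨_, _, h.isScRetraction S.isScAtlas hc hr ht, h.image_retraction hr ht⟩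
  cover y := by
    obtain ⟨N, hN, hy, H, hH, hs⟩ := ho.2.2 y
    obtain ⟨c, hc, hyc⟩ := S.cover (H y)
    exact ⟨_, ⟨c, hc, N, H, ⟨ho.1, hN, hH, hs⟩, rfl⟩, hy, hyc⟩
  compat := by
    rintro _ ⟨c, hc, N, H, h, rfl⟩ q hq
    obtain ⟨U, r, hr, ht⟩ := S.retract c hc
    have hR := h.isScRetraction S.isScAtlas hc hr ht
    refine smoothTransition_of_isPlot (c := h.chart c) hR (h.image_retraction hr ht)
      (B := imprintingCharts S.charts oplus) ?_ hq
    have h1 := ((S.isScAtlas.isPlot_param hc hr ht).oplus_comp S.isScAtlas ho.1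
      hr.isScDomain).mono (inter_subset_left (t := c.param r ⁻¹' (oplus ⁻¹' N ∩
        (H ∘ oplus) ⁻¹' c.e.source)))
    exact h1.congr fun u hu => h.chart_param_retraction hu

end Imprinting

/-! ### Tameness and the properties of the induced structure -/

section TameImprinting

variable {X : Type u₁} [TopologicalSpace X] {Y : Type u₃} [TopologicalSpace Y]
  {V : Type u₄} [TopologicalSpace V] {S S' : MPolyfold.{u₁, u₂} X} {R R' : MPolyfold.{u₄, u₅} V}
  {oplus : X → Y} {p : X → V} {p' : Y → V}

/-- If `oplus` is compatible with a submersion that preserves the degeneracy index, then the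
retraction of a tame chart induced by a local section is tame. -/
theorem IsImprintingSection.isTameRetraction {N : Set Y} {H : Y → X}
    (h : IsImprintingSection S.charts oplus N H) (hR : ∀ d ∈ R.charts, d.C.IsRelOpen d.e.target)
    (hp : S.Smooth R p) (hsub : S.HasSubmersionProperty R p)
    (hd : ∀ x, R.degeneracy (p x) = S.degeneracy x) (hp' : p' ∘ oplus = p)
    {c : ModelChart.{u₁, u₂} X} (hc : c ∈ S.charts) {U : Set (c.E.lev 0)}
    {r : c.E.lev 0 → c.E.lev 0} (hr : IsTameRetraction c.C U r) (ht : r '' U = c.e.target) :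
    IsTameRetraction c.C (domain oplus N H c U r) (retraction oplus H c r) := by
  have hs := h.isScRetraction S.isScAtlas hc hr.1 ht
  have hct : IsTameRetract c.C c.e.target := ⟨U, r, hr, ht⟩
  have hpH : ∀ x, oplus x ∈ N → p (H (oplus x)) = p x := fun x hx => by
    rw [← hp', Function.comp_apply, Function.comp_apply, h.right_inv _ hx]
  have hS : ∀ x ∈ c.e.source, S.degeneracy x = c.C.degeneracy (c.e x) := fun x hx =>
    (MPolyfold.isChart_of_mem hc).degeneracy_eq hct hx
  refine ⟨hs, fun u hu => ?_, fun x hx hxW => ?_⟩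
  · change c.C.degeneracy (c.e (H (oplus (c.param r u)))) = _
    have hHc : H (oplus (c.param r u)) ∈ c.e.source := hu.2.2
    rw [← hS _ hHc, ← hd, hpH _ hu.2.1, hd, hS _ (mapsTo_param ht hu.1), e_param ht hu.1,
      hr.2.1 u hu.1]
  set W := domain oplus N H c U r with hW
  set T := retraction oplus H c r with hT
  have hxU : c.E.incl 0 x ∈ W := hs.image_subset hxW
  have hTx : T (c.E.incl 0 x) = c.E.incl 0 x := hs.eq_of_mem_image hxW
  have hxt : c.E.incl 0 x ∈ c.e.target := by
    have := (h.image_retraction hr.1 ht).le hxW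
    exact this.1
  have hrx : r (c.E.incl 0 x) = c.E.incl 0 x := hr.1.eq_of_mem_image (ht ▸ hxt)
  obtain ⟨P₀, hP, A, hA, hPA, hAx⟩ := hr.2.2 x hx (ht ▸ hxt)
  obtain ⟨Q₀, hQ⟩ := hs.smooth.exists_hasScDerivAt hxU
  obtain ⟨P, rfl⟩ := hP.exists_scOp hr.1.smooth hr.1.isScDomain hxU.1 hx
  obtain ⟨Q, rfl⟩ := hQ.exists_scOp hs.smooth hs.isScDomain hxU hx
  have hpar : ∀ u ∈ U, c.param r (r u) = c.param r u := fun u hu => by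
    rw [param, Function.comp_apply, Function.comp_apply, hr.1.idem u hu]
  have hrW : MapsTo r W W := fun u hu => ⟨hr.1.mapsTo hu.1, by
    rw [mem_preimage, hpar u hu.1]; exact hu.2⟩
  have hTU : MapsTo T W U := fun u hu => (hs.mapsTo hu).1
  have hPP : (P.map 0).comp (P.map 0) = P.map 0 :=
    (hP.comp_of_scSmooth hP hr.1.smooth hr.1.smooth hr.1.isScDomain hr.1.mapsTo hxU.1
      hrx.symm).unique hr.1.isScDomain hxU.1 (hP.congr (fun u hu => hr.1.idem u hu) hxU.1)
  have hQQ : (Q.map 0).comp (Q.map 0) = Q.map 0 :=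
    (hQ.comp_of_scSmooth hQ hs.smooth hs.smooth hs.isScDomain hs.mapsTo hxU
      hTx.symm).unique hs.isScDomain hxU (hQ.congr (fun u hu => hs.idem u hu) hxU)
  -- Derivative of r ∘ T = T, as T takes values in the image of r.
  have hPQ : (P.map 0).comp (Q.map 0) = Q.map 0 :=
    (hP.comp_of_scSmooth hQ hr.1.smooth hs.smooth hr.1.isScDomain hTU hxU
      hTx.symm).unique hs.isScDomain hxU (hQ.congr (fun u hu => hr.1.eq_of_mem_image
        (ht ▸ c.e.map_source hu.2.2)) hxU)
  -- Derivative of T ∘ r = T, as T depends on its argument only through r.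
  have hQP : (Q.map 0).comp (P.map 0) = Q.map 0 :=
    (hQ.comp_of_scSmooth (hP.mono inter_subset_left) hs.smooth
      (hr.1.smooth.mono inter_subset_left) hs.isScDomain hrW hxU
      hrx.symm).unique hs.isScDomain hxU (hQ.congr (fun u hu => by
        change c.e (H (oplus (c.param r (r u)))) = c.e (H (oplus (c.param r u)))
        rw [hpar u hu.1]) hxU)
  obtain ⟨A', hA', hQA, hsum⟩ := exists_scComplement (DFunLike.congr_fun hPP)
    (DFunLike.congr_fun hQQ) (DFunLike.congr_fun hPQ) (DFunLike.congr_fun hQP) hA hPA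
  refine ⟨Q.map 0, hQ, A', hA', hQA, fun v hv => ?_⟩
  obtain ⟨w, a, ha, rfl⟩ := hsum v hv
  obtain ⟨d, hdR, hxd⟩ := R.cover (p (c.param r (c.E.incl 0 x)))
  have hpπ : IsPlot R.charts U (p ∘ c.param r) :=
    (S.isScAtlas.isPlot_param hc hr.1 ht).map hr.1.isScDomain S.cover hp (mapsTo_univ _ _)
  have hf := hpπ.2 d hdR
  have hUf := hpπ.isScDomain_inter hr.1.isScDomain d.open_source
  obtain ⟨G, hG, hGe⟩ := exists_isOpen_inter_preimage hpπ.1 d.open_source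
  set Uf := U ∩ (p ∘ c.param r) ⁻¹' d.e.source with hUfdef
  have hxf : c.E.incl 0 x ∈ Uf := ⟨hxU.1, hxd⟩
  obtain ⟨L, hL⟩ := hf.exists_hasScDerivAt hxf
  have hsurj := hsub.surjective_scDeriv hp hc hr.1 ht hdR (hR d hdR) hxt hxd hL
  have hLP : L.comp (P.map 0) = L :=
    (hL.comp_of_scSmooth (hP.mono inter_subset_left) hf (hr.1.smooth.mono inter_subset_left) hUf
      (fun u hu => ⟨hr.1.mapsTo hu.1, by
        rw [mem_preimage, Function.comp_apply, hpar u hu.1]; exact hu.2⟩) hxf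
      hrx.symm).unique hUf hxf (hL.congr (fun u hu => by
        simp only [Function.comp_apply, hpar u hu.1]) hxf)
  have hpT : ∀ u ∈ W, p (c.param r (T u)) = p (c.param r u) := fun u hu => by
    rw [← hpH _ (hs.mapsTo hu).2.1, h.oplus_param_retraction hr.1 ht hu, hpH _ hu.2.1]
  have hWG : W ∩ (p ∘ c.param r) ⁻¹' d.e.source = W ∩ G := Set.ext fun u =>
    ⟨fun hu => ⟨hu.1, (hGe.le ⟨hu.1.1, hu.2⟩).2⟩, fun hu => ⟨hu.1, (hGe.ge ⟨hu.1.1, hu.2⟩).2⟩⟩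
  have hWf : IsScDomain (W ∩ (p ∘ c.param r) ⁻¹' d.e.source) :=
    hWG ▸ hs.isScDomain.inter_open hG
  have hLQ : L.comp (Q.map 0) = L :=
    (hL.comp_of_scSmooth (hQ.mono inter_subset_left) hf (hs.smooth.mono inter_subset_left) hUf
      (fun u hu => ⟨hTU hu.1, by
        rw [mem_preimage, Function.comp_apply, hpT u hu.1]; exact hu.2⟩)
      (show c.E.incl 0 x ∈ W ∩ (p ∘ c.param r) ⁻¹' d.e.source from ⟨hxU, hxd⟩)
      hTx.symm).unique hWf ⟨hxU, hxd⟩ ((hL.mono fun u hu => ⟨hu.1.1, hu.2⟩).congr (fun u hu => by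
        simp only [Function.comp_apply, hpT u hu.1]) ⟨hxU, hxd⟩)
  -- Neither r nor T changes the value of p, so L P = L = L Q.
  have hker : L (P.map 0 w - Q.map 0 w) = 0 := by
    rw [map_sub, sub_eq_zero]
    exact (DFunLike.congr_fun hLP w).trans (DFunLike.congr_fun hLQ w).symm
  have hface := hL.mapsTo_facePlane (C := c.C) (C' := d.C) (hGe ▸ hr.1.relOpen.inter_open hG) hxf
    fun u hu => (hR d hdR).subset_carrier (d.e.map_source hu.2)
  -- Both charts are tame, so the intrinsic equality of degeneracy indices becomes one between the
  -- two quadrants.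
  have hdeg : c.C.degeneracy (c.E.incl 0 x) =
      d.C.degeneracy ((d.e ∘ p ∘ c.param r) (c.E.incl 0 x)) := by
    have h1 := hS _ (mapsTo_param ht hxU.1)
    rw [e_param ht hxU.1, hrx, ← hd, (MPolyfold.isChart_of_mem hdR).degeneracy_eq
      ⟨_, id, (hR d hdR).isTameRetraction, image_id _⟩ hxd] at h1
    exact h1.symm
  have h1 := PartialQuadrant.mem_facePlane_of_surjective hface hsurj hdeg hker
  rw [← PartialQuadrant.faceMap_eq_zero_iff] at h1
  have h2 := (PartialQuadrant.faceMap_eq_zero_iff _ _ _).2 (hAx ha)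
  rw [← PartialQuadrant.faceMap_eq_zero_iff, map_add, h1, h2, add_zero]

/-! ## Equivalent atlases -/

/-- Equivalent atlases have the same plots on sc-domains, and plots determine smoothness. -/
theorem ScSmoothMapOn.of_equivalent (h : S.Equivalent S') (h' : R.Equivalent R') {f : X → V}
    {W : Set X} (hW : IsOpen W) (hf : S.SmoothOn R f W) : S'.SmoothOn R' f W :=
  S'.isScAtlas.scSmoothMapOn hW fun _ _ _ hU hα hm =>
    h'.isPlot hU ((h.symm.isPlot hU hα).map hU S.cover hf hm)

theorem MPolyfold.Equivalent.isPlot_prod (h : S.Equivalent S') (h' : R.Equivalent R')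
    {E : ScBanach.{u₆}} {U : Set (E.lev 0)} {γ : E.lev 0 → X × V} (hU : IsScDomain U)
    (hγ : IsPlot (prodCharts S.charts R.charts) U γ) :
    IsPlot (prodCharts S'.charts R'.charts) U γ :=
  (h.isPlot hU (hγ.fst hU R.cover)).prodMk (h'.isPlot hU (hγ.snd hU S.cover))

theorem MPolyfold.HasSubmersionProperty.of_equivalent (h : S.Equivalent S') (h' : R.Equivalent R')
    (hp : S.HasSubmersionProperty R p) : S'.HasSubmersionProperty R' p := by
  refine ⟨hp.1, fun x => ?_⟩
  obtain ⟨N, hN, hx, ρ, hρN, hρ, h2⟩ := hp.2 x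
  refine ⟨N, hN, hx, ρ, hρN, ?_, h2⟩
  exact (S'.isScAtlas.prod R'.isScAtlas).scSmoothMapOn hN fun E U γ hU hγ hm =>
    h.isPlot_prod h' hU ((h.symm.isPlot_prod h'.symm hU hγ).map hU
      (S.isScAtlas.prod R.isScAtlas).cover hρ hm)

theorem MPolyfold.Equivalent.refl (S : MPolyfold.{u₁, u₂} X) : S.Equivalent S :=
  fun c hc c' hc' => ⟨S.compat c hc c' hc', S.compat c' hc' c hc⟩

theorem MPolyfold.IsImprinting.of_equivalent (h : S.Equivalent S') (ho : S.IsImprinting oplus) :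
    S'.IsImprinting oplus := by
  refine ⟨ho.1, ho.2.1, fun y => ?_⟩
  obtain ⟨N, hN, hy, H, hH, hs⟩ := ho.2.2 y
  exact ⟨N, hN, hy, H, hH, ScSmoothMapOn.of_equivalent h h (hN.preimage ho.1.continuous) hs⟩

theorem MPolyfold.IsInducedBy.of_equivalent (h : S.Equivalent S') {Q : MPolyfold.{u₃, u₂} Y}
    (hQ : Q.IsInducedBy S oplus) : Q.IsInducedBy S' oplus := by
  refine ⟨ScSmoothMapOn.of_equivalent h (.refl Q) isOpen_univ hQ.1, fun y => ?_⟩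
  obtain ⟨N, hN, hy, H, hH, hs⟩ := hQ.2 y
  exact ⟨N, hN, hy, H, hH, ScSmoothMapOn.of_equivalent (.refl Q) h hN hs⟩

/-! ## Properties of the induced structure -/

theorem MPolyfold.IsImprinting.exists_section (ho : S.IsImprinting oplus) (y : Y) :
    ∃ N H, IsImprintingSection S.charts oplus N H ∧ y ∈ N := by
  obtain ⟨N, hN, hy, H, hH, hs⟩ := ho.2.2 y
  exact ⟨N, H, ⟨ho.1, hN, hH, hs⟩, hy⟩

variable (ho : S.IsImprinting oplus)

theorem imprintingStructure_isInducedBy :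
    (imprintingStructure S oplus ho).IsInducedBy S oplus := by
  refine ⟨S.isScAtlas.scSmoothMapOn isOpen_univ fun E U α hU hα _ =>
    hα.oplus_comp S.isScAtlas ho.1 hU, fun y => ?_⟩
  obtain ⟨N, H, h, hy⟩ := ho.exists_section y
  exact ⟨N, h.isOpen, hy, H, h.right_inv,
    (imprintingStructure S oplus ho).isScAtlas.scSmoothMapOn h.isOpen
      fun E U α _ hα hm => h.isPlot_comp hα hm⟩

/-- Locally α = ⊕ ∘ (H ∘ α): the section is smooth for Q, and ⊕ is smooth into Q'. -/
theorem MPolyfold.IsInducedBy.isPlot_imp {Q Q' : MPolyfold.{u₃, u₂} Y}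
    (hQ : Q.IsInducedBy S oplus) (hQ' : Q'.IsInducedBy S oplus) {E : ScBanach.{u₆}}
    {U : Set (E.lev 0)} {α : E.lev 0 → Y} (hU : IsScDomain U) (hα : IsPlot Q.charts U α) :
    IsPlot Q'.charts U α := by
  refine IsPlot.of_local hU fun u hu => ?_
  obtain ⟨N, hN, hy, H, hH, hs⟩ := hQ.2 (α u)
  obtain ⟨G, hG, e⟩ := exists_isOpen_inter_preimage hα.1 hN
  have hm : MapsTo α (U ∩ G) N := fun w hw => (e.ge hw).2
  refine ⟨G, hG, (e.le ⟨hu, hy⟩).2, ?_⟩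
  have hUG := hU.inter_open hG
  have h1 := (hα.mono inter_subset_left).map hUG Q.cover hs hm
  exact (h1.map hUG S.cover hQ'.1 (mapsTo_univ _ _)).congr fun w hw => (hH _ (hm hw)).symm

/-- The induced structure is unique. -/
theorem MPolyfold.IsInducedBy.equivalent {Q Q' : MPolyfold.{u₃, u₂} Y}
    (hQ : Q.IsInducedBy S oplus) (hQ' : Q'.IsInducedBy S oplus) : Q.Equivalent Q' := by
  intro c hc c' hc'
  obtain ⟨U, r, hr, ht⟩ := Q.retract c hc
  obtain ⟨U', r', hr', ht'⟩ := Q'.retract c' hc'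
  exact ⟨smoothTransition_of_isPlot hr ht
      (hQ.isPlot_imp hQ' hr.isScDomain (Q.isScAtlas.isPlot_param hc hr ht)) hc',
    smoothTransition_of_isPlot hr' ht'
      (hQ'.isPlot_imp hQ hr'.isScDomain (Q'.isScAtlas.isPlot_param hc' hr' ht')) hc⟩

theorem MPolyfold.IsInducedBy.smooth_of_comp {Q : MPolyfold.{u₃, u₂} Y}
    (hQ : Q.IsInducedBy S oplus) (hp : S.Smooth R p) (hp' : p' ∘ oplus = p) :
    Q.Smooth R p' := by
  refine Q.isScAtlas.scSmoothMapOn isOpen_univ fun E U α hU hα _ =>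
    IsPlot.of_local hU fun u hu => ?_
  obtain ⟨N, hN, hy, H, hH, hs⟩ := hQ.2 (α u)
  obtain ⟨G, hG, e⟩ := exists_isOpen_inter_preimage hα.1 hN
  have hm : MapsTo α (U ∩ G) N := fun w hw => (e.ge hw).2
  refine ⟨G, hG, (e.le ⟨hu, hy⟩).2, ?_⟩
  have hUG := hU.inter_open hG
  have h1 := (hα.mono inter_subset_left).map hUG Q.cover hs hm
  refine (h1.map hUG S.cover hp (mapsTo_univ _ _)).congr fun w hw => ?_
  simp only [← hp', Function.comp_apply, hH _ (hm hw)]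

/-- The retraction is (y, v) ↦ (⊕ ρ̄(H y, v), v). It lands in the graph of p' because p' ∘ ⊕ = p,
and fixes graph points because (H y, p' y) lies on the graph of p. -/
theorem MPolyfold.IsInducedBy.hasSubmersionProperty {Q : MPolyfold.{u₃, u₂} Y}
    (hQ : Q.IsInducedBy S oplus) (hsub : S.HasSubmersionProperty R p) (hp' : p' ∘ oplus = p) :
    Q.HasSubmersionProperty R p' := by
  have hpo : ∀ x, p' (oplus x) = p x := congrFun hp'
  refine ⟨fun v => ?_, fun y => ?_⟩
  · obtain ⟨x, rfl⟩ := hsub.1 v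
    exact ⟨oplus x, hpo x⟩
  obtain ⟨N, hN, hy, H, hH, hs⟩ := hQ.2 y
  obtain ⟨M, hM, hyM, ρ, hρM, hρ, hρ2, hρρ, hρim⟩ := hsub.2 (H y)
  have hpH : ∀ y ∈ N, p (H y) = p' y := fun y hy => by rw [← hpo, hH y hy]
  have hgraph : ∀ q ∈ M, p q.1 = q.2 → ρ q = q := fun q hq hpq => by
    have h1 : q ∈ ρ '' M := hρim ▸ ⟨hq, hpq⟩
    obtain ⟨q', hq', rfl⟩ := h1
    exact hρρ q' hq'
  have hpρ : ∀ q ∈ M, p (ρ q).1 = q.2 := fun q hq => by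
    have h1 : ρ q ∈ M ∩ {q | p q.1 = q.2} := hρim ▸ mem_image_of_mem ρ hq
    exact h1.2.trans (hρ2 q hq)
  let j : Y × V → X × V := Prod.map H id
  let k : X × V → Y × V := Prod.map oplus id
  have hco : Continuous oplus := continuousOn_univ.1 hQ.1.1
  have hck : Continuous k := hco.prodMap continuous_id
  have hcj : ContinuousOn j (N ×ˢ univ) := hs.1.prodMap continuousOn_id
  have hNu : IsOpen (N ×ˢ (univ : Set V)) := hN.prod isOpen_univ
  have hO₁ : IsOpen (N ×ˢ univ ∩ j ⁻¹' M) := hcj.isOpen_inter_preimage hNu hM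
  have hcσ : ContinuousOn (k ∘ ρ ∘ j) (N ×ˢ univ ∩ j ⁻¹' M) :=
    hck.comp_continuousOn (hρ.1.comp (hcj.mono inter_subset_left) fun q hq => hq.2)
  -- The composite may leave the set where it is defined. Requiring its value to lie there suffices,
  -- since that value is then a fixed point.
  have hO₂ : IsOpen ((N ×ˢ univ ∩ j ⁻¹' M) ∩ (k ∘ ρ ∘ j) ⁻¹' (N ×ˢ univ ∩ j ⁻¹' M)) :=
    hcσ.isOpen_inter_preimage hO₁ hO₁
  set D := (N ×ˢ univ ∩ j ⁻¹' M) ∩ (k ∘ ρ ∘ j) ⁻¹' (N ×ˢ univ ∩ j ⁻¹' M) with hD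
  have hfix : ∀ q ∈ N ×ˢ univ ∩ j ⁻¹' M, p' q.1 = q.2 → (k ∘ ρ ∘ j) q = q := by
    rintro ⟨y', v⟩ ⟨hqN, hqM⟩ hpq
    have h1 : ρ (j (y', v)) = j (y', v) := hgraph _ hqM ((hpH _ hqN.1).trans hpq)
    simp only [Function.comp_apply, h1]
    exact Prod.ext (hH _ hqN.1) rfl
  have hgr : ∀ q ∈ N ×ˢ univ ∩ j ⁻¹' M, p' ((k ∘ ρ ∘ j) q).1 = ((k ∘ ρ ∘ j) q).2 := by
    intro q hq
    change p' (oplus (ρ (j q)).1) = (ρ (j q)).2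
    rw [hpo, hpρ _ hq.2, hρ2 _ hq.2]
  have hmem : ∀ q ∈ N ×ˢ univ ∩ j ⁻¹' M, p' q.1 = q.2 → q ∈ D := fun q hq hpq =>
    ⟨hq, by rw [mem_preimage, hfix q hq hpq]; exact hq⟩
  refine ⟨D, hO₂, hmem _ ⟨⟨hy, mem_univ _⟩, ?_⟩ rfl, k ∘ ρ ∘ j,
    fun q hq => hmem _ hq.2 (hgr q hq.1), ?_, fun q hq => hρ2 _ hq.1.2,
    fun q hq => hfix _ hq.2 (hgr q hq.1), Subset.antisymm ?_ ?_⟩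
  · change (H y, p' y) ∈ M
    rwa [← hpH y hy]
  · refine (Q.isScAtlas.prod R.isScAtlas).scSmoothMapOn hO₂ fun E U γ hU hγ hm => ?_
    have h1 := (hγ.fst hU R.cover).map hU Q.cover hs fun u hu => (hm hu).1.1.1
    have h2 := hγ.snd hU Q.cover
    have h3 := (h1.prodMk h2).map hU (S.isScAtlas.prod R.isScAtlas).cover hρ
      fun u hu => (hm hu).1.2
    have h4 := (h3.fst hU R.cover).map hU S.cover hQ.1 (mapsTo_univ _ _)
    exact h4.prodMk (h3.snd hU S.cover)
  · rintro _ ⟨q, hq, rfl⟩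
    exact ⟨hmem _ hq.2 (hgr q hq.1), hgr q hq.1⟩
  · rintro q ⟨hq, hpq⟩
    exact ⟨q, hq, hfix q hq.1 hpq⟩

end TameImprinting

/-! ### The theorem -/

theorem mainTheorem7 {X : Type u} [TopologicalSpace X] {V : Type w} [TopologicalSpace V]
    {Y : Type t} [TopologicalSpace Y] (SX : MPolyfold.{u, v} X) (hX : SX.IsTame)
    (SV : MPolyfold.{w, z} V) (hV : SV.IsFiniteDimManifold)
    (p : X → V) (hp : SX.Smooth SV p) (hsub : SX.HasSubmersionProperty SV p)
    (hd : ∀ x, SV.degeneracy (p x) = SX.degeneracy x)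
    (oplus : X → Y) (hoplus : SX.IsImprinting oplus)
    (p' : Y → V) (hp' : p' ∘ oplus = p) :
    ∃ SY : MPolyfold.{t, v} Y, SY.IsInducedBy SX oplus ∧
      (∀ SY' : MPolyfold.{t, v} Y, SY'.IsInducedBy SX oplus → SY.Equivalent SY') ∧
      SY.IsTame ∧
      (SY.Smooth SV p' ∧ SY.HasSubmersionProperty SV p') ∧
      ∀ y, SV.degeneracy (p' y) = SY.degeneracy y := by
  -- The structure on Y is built from the tame atlas of X and the manifold atlas of V; all
  -- hypotheses are invariant under equivalence.
  obtain ⟨-, S, hS, htame⟩ := hX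
  obtain ⟨R, hR, hRo, -⟩ := hV
  have ho : S.IsImprinting oplus := hoplus.of_equivalent hS
  have hpS : S.Smooth R p := ScSmoothMapOn.of_equivalent hS hR isOpen_univ hp
  have hsubS : S.HasSubmersionProperty R p := hsub.of_equivalent hS hR
  have hdS : ∀ x, R.degeneracy (p x) = S.degeneracy x := fun x => by
    rw [← hR.degeneracy_eq, ← hS.degeneracy_eq, hd]
  have hind := MPolyfold.IsInducedBy.of_equivalent hS.symm (imprintingStructure_isInducedBy ho)
  have htameY : ∀ c ∈ (imprintingStructure S oplus ho).charts, IsTameRetract c.C c.e.target := by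
    rintro _ ⟨c, hc, N, H, h, rfl⟩
    obtain ⟨U, r, hr, ht⟩ := htame c hc
    exact ⟨_, _, h.isTameRetraction (fun d hd => (hRo d hd).2) hpS hsubS hdS hp' hc hr ht,
      h.image_retraction hr.1 ht⟩
  refine ⟨imprintingStructure S oplus ho, hind, fun SY' h => MPolyfold.IsInducedBy.equivalent hind h,
    ⟨hoplus.2.1, _, .refl _, htameY⟩,
    ⟨MPolyfold.IsInducedBy.smooth_of_comp hind hp hp',
      MPolyfold.IsInducedBy.hasSubmersionProperty hind hsub hp'⟩, fun y => ?_⟩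
  obtain ⟨N, H, h, hy⟩ := ho.exists_section y
  obtain ⟨c, hc, hyc⟩ := S.cover (H y)
  have hq : h.chart c ∈ (imprintingStructure S oplus ho).charts := ⟨c, hc, N, H, h, rfl⟩
  -- Tame charts φ ∘ H and φ give d_Y(y) = d_C(φ(H y)) = d_X(H y) = d_V(p(H y)) = d_V(p'(y)).
  rw [(MPolyfold.isChart_of_mem hq).degeneracy_eq (htameY _ hq) ⟨hy, hyc⟩]
  change _ = c.C.degeneracy (c.e (H y))
  rw [← (MPolyfold.isChart_of_mem hc).degeneracy_eq (htame c hc) hyc, ← hdS, hR.degeneracy_eq,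
    ← hp', Function.comp_apply, h.right_inv y hy]
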